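/- **Setting.** Let $\mathtt{cvx}(\mathbb{R}^d)$ be the set of lower semicontinuous proper convex functions $f:\mathbb{R}^d\to(-\infty,+\infty]$, with conjugate $f^\star(y)=\sup_x[\langle x,y\rangle-f(x)]$ and subdifferential $\partial f$. For measures $\mu,\nu$ on $\mathbb{R}^d$ put $$W_2^2(\mu,\nu)=\inf_{\pi\in\Pi(\mu,\nu)}\int\tfrac12\|x-y\|_2^2\,d\pi(x,y)\in[0,\infty],$$ where $\Pi(\mu,\nu)$ is the set of joint measures with marginals $\mu$ and $\nu$ (the infimum is $\infty$ if there is none). For $\mathcal F\subset\mathtt{cvx}(\mathbb{R}^d)$ put $$W_{2,\mathcal F}^2(\mu,\nu)=\int\tfrac12\|x\|_2^2\,d\mu+\int\tfrac12\|y\|_2^2\,d\nu-\inf_{f\in\mathcal F}\Big[\int f\,d\mu+\int f^\star\,d\nu\Big].$$ For nonnegative finite measures $\lambda,\mu$ write $\lambda\preceq_{\mathcal F}\mu$ (equivalently $\mu\succeq_{\mathcal F}\lambda$) if $\int f\,d\lambda\le\int f\,d\mu$ for all $f\in\mathcal F$. Let $$\nabla\mathcal F\#\mu=\{T\#\mu:\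 T \text{ measurable and, for some } f\in\mathcal F,\ T(x)\in\partial f(x)\text{ for }\mu\text{-a.e. }x\}.$$ **Theorem.** Let $\mu,\nu$ be probability measures on $\mathbb{R}^d$ with finite second moments, and let $\mathcal F\subset\mathtt{cvx}(\mathbb{R}^d)$ be a convex cone ($\mathcal F\neq\emptyset$, and $\alpha f+\beta g\in\mathcal F$ for all $f,g\in\mathcal F$ and $\alpha,\beta\ge0$, where $0\cdot\infty=0$) with $\|\cdot\|_2^2\in\mathcal F$. Then $W_{2,\mathcal F}^2(\mu,\nu)$ is a nonnegative real number; let $W_{2,\mathcal F}(\mu,\nu)$ be its square root. Moreover: 1. (Duality) With $\lambda$ ranging over the nonnegative finite measures on $\mathbb{R}^d$, $$W_{2,\mathcal F}^2(\mu,\nu)=\inf_{\lambda\preceq_{\mathcal F}\mu}\Big[W_2^2(\lambda,\nu)+\int\tfrac12\|x\|_2^2\,d\mu(x)-\int\tfrac12\|x\|_2^2\,d\lambda(x)\Big]\ \ge\ \inf_{\lambda\preceq_{\mathcal F}\mu}W_2^2(\lambda,\nu).$$ 2. (Moment matching) $W_{2,\mathcal F}(\mu,\nu)=0$ if and only if $\mu\succeq_{\mathcal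 F}\nu$ and $\int\|x\|_2^2\,d\mu=\int\|x\|_2^2\,d\nu$. 3. (Embedding) If $\nu\in\nabla\mathcal F\#\mu$, then $W_{2,\mathcal F}(\mu,\nu)=W_2(\mu,\nu)$. Otherwise $$W_{2,\mathcal F}(\mu,\nu)\le W_2(\mu,\nu)\le\big(2W_{2,\mathcal F}^2(\mu,\nu)+2\epsilon^2\big)^{1/2}+\epsilon,\qquad \epsilon:=\inf_{\lambda\in\nabla\mathcal F\#\mu}W_2(\lambda,\nu).$$ In all cases $\epsilon$ and $W_2(\mu,\nu)$ are finite. Finally, $W_{2,\mathcal F}$ is not necessarily symmetric: for some $d$ and some $\mathcal F$ as above there are probability measures $\mu,\nu$ with finite second moments such that $W_{2,\mathcal F}(\mu,\nu)\ne W_{2,\mathcal F}(\nu,\mu)$. -/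

import Mathlib

open MeasureTheory
open scoped ENNReal

noncomputable section

namespace ConicOT

/-- The Euclidean space `ℝ^d`. -/
abbrev Space (d : ℕ) : Type := EuclideanSpace ℝ (Fin d)

/-- Extended-real-valued functions on `ℝ^d`. -/
abbrev EFun (d : ℕ) : Type := Space d → EReal

/-- The set of lower semicontinuous proper convex functions `ℝ^d → (-∞, +∞]`.
Convexity is convexity of the epigraph. -/
def cvx (d : ℕ) : Set (EFun d) :=
  {f | LowerSemicontinuous f ∧
    Convex ℝ {p : Space d × ℝ | f p.1 ≤ (p.2 : EReal)} ∧
    (∀ x, f x ≠ ⊥) ∧ ∃ x, f x ≠ ⊤}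

/-- `F` is a convex cone of functions: a nonempty class that is stable under all combinations
`α f + β g` with real `α, β ≥ 0` (with `0 * (+∞) = 0`). -/
def IsFunctionCone {d : ℕ} (F : Set (EFun d)) : Prop :=
  F.Nonempty ∧ ∀ f ∈ F, ∀ g ∈ F, ∀ α β : ℝ, 0 ≤ α → 0 ≤ β →
    (fun x => (α : EReal) * f x + (β : EReal) * g x) ∈ F

/-- The function `x ↦ ‖x‖²`. -/
def normSq (d : ℕ) : EFun d := fun x => ((‖x‖ ^ 2 : ℝ) : EReal)

/-- The convex conjugate `f⋆(y) = sup_x (⟨x, y⟩ - f x)`. -/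
def conjugate {d : ℕ} (f : EFun d) : EFun d :=
  fun y => ⨆ x, (((inner ℝ x y : ℝ) : EReal) - f x)

/-- The integral `∫ f dμ` of an extended-real-valued function: the integral of the positive part
minus the integral of the negative part. It is meaningful as soon as one of the two is finite;
this is so for every `f` in `cvx d` and every finite `μ` with finite first moment. -/
def eintegral {d : ℕ} (μ : Measure (Space d)) (f : EFun d) : EReal :=
  ((∫⁻ x, (f x).toENNReal ∂μ : ℝ≥0∞) : EReal) - ((∫⁻ x, (-f x).toENNReal ∂μ : ℝ≥0∞) : EReal)

/-- The preorder `μ ⪯_F ν`: `∫ f dμ ≤ ∫ f dν` for all `f ∈ F`. -/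
def MomentLE {d : ℕ} (F : Set (EFun d)) (μ ν : Measure (Space d)) : Prop :=
  ∀ f ∈ F, eintegral μ f ≤ eintegral ν f

/-- The nonnegative finite measures `κ` on `ℝ^d` with `κ ⪯_F μ`. -/
def lowerSet {d : ℕ} (F : Set (EFun d)) (μ : Measure (Space d)) : Set (Measure (Space d)) :=
  {κ | IsFiniteMeasure κ ∧ MomentLE F κ μ}

/-- `∫ ½‖x‖² dμ`, as an element of `[0, ∞]`. -/
def halfMoment {d : ℕ} (μ : Measure (Space d)) : ℝ≥0∞ :=
  ∫⁻ x, ENNReal.ofReal (1 / 2 * ‖x‖ ^ 2) ∂μ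

/-- The couplings of `μ` and `ν`: joint measures with marginals `μ` and `ν`. -/
def couplings {d : ℕ} (μ ν : Measure (Space d)) : Set (Measure (Space d × Space d)) :=
  {π | π.map Prod.fst = μ ∧ π.map Prod.snd = ν}

/-- `W₂²(μ, ν)`: the infimum of `∫ ½‖x - y‖² dπ` over all couplings `π`
(it is `∞` if there is none, i.e. if the masses differ). -/
def W2sq {d : ℕ} (μ ν : Measure (Space d)) : ℝ≥0∞ :=
  ⨅ π ∈ couplings μ ν, ∫⁻ p, ENNReal.ofReal (1 / 2 * ‖p.1 - p.2‖ ^ 2) ∂π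

/-- `W₂(μ, ν)`. -/
def W2 {d : ℕ} (μ ν : Measure (Space d)) : ℝ≥0∞ := W2sq μ ν ^ (1 / 2 : ℝ)

/-- `W²_{2,F}(μ, ν) = ∫ ½‖x‖² dμ + ∫ ½‖y‖² dν - inf_{f ∈ F} (∫ f dμ + ∫ f⋆ dν)`. -/
def W2Fsq {d : ℕ} (F : Set (EFun d)) (μ ν : Measure (Space d)) : EReal :=
  (halfMoment μ : EReal) + (halfMoment ν : EReal)
    - ⨅ f ∈ F, (eintegral μ f + eintegral ν (conjugate f))

/-- `W_{2,F}(μ, ν)`, the square root of `W²_{2,F}(μ, ν)`; meaningful where the latter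
is nonnegative. -/
def W2F {d : ℕ} (F : Set (EFun d)) (μ ν : Measure (Space d)) : ℝ≥0∞ :=
  (W2Fsq F μ ν).toENNReal ^ (1 / 2 : ℝ)

/-- The subdifferential `∂f(x)`. -/
def subdiff {d : ℕ} (f : EFun d) (x : Space d) : Set (Space d) :=
  {y | ∀ z, f x + ((inner ℝ y (z - x) : ℝ) : EReal) ≤ f z}

/-- `∇F#μ`: all push-forwards `T#μ` by measurable maps `T` such that, for some `f ∈ F`,
`T x ∈ ∂f(x)` for `μ`-almost every `x`. -/
def gradPush {d : ℕ} (F : Set (EFun d)) (μ : Measure (Space d)) : Set (Measure (Space d)) :=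
  {κ | ∃ f ∈ F, ∃ T : Space d → Space d,
    Measurable T ∧ (∀ᵐ x ∂μ, T x ∈ subdiff f x) ∧ κ = μ.map T}

/-- `ε = inf_{κ ∈ ∇F#μ} W₂(κ, ν)`. -/
def approxError {d : ℕ} (F : Set (EFun d)) (μ ν : Measure (Space d)) : ℝ≥0∞ :=
  ⨅ κ ∈ gradPush F μ, W2 κ ν

end ConicOT

end

/-! Write `V` for the infimum over `F` of `∫ f dμ + ∫ f⋆ dν` and `M` for half the second moment, so
that `W²_{2,F}(μ, ν) = M(μ) + M(ν) - V`. Everything rests on reading `V` as the largest correlation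
`∫ ⟨x, y⟩ dπ` over couplings `π` of some `κ ⪯_F μ` with `ν`. One half is Fenchel-Young followed by
`∫ f dκ ≤ ∫ f dμ` (`integral_inner_le_of_momentLE`).

The other half, `exists_optimal_map`, yields a maximiser of the form `κ = T#ν`. For finitely many `f
i ∈ F`, one of them `‖·‖²`, and strictly positive weights of sum one, `g = ∑ w i f i` is a strongly
convex member of the cone. So `⟨x, y⟩ - g x` is maximal at a point `T y` that is Lipschitz in `y`,
and the weighted Lagrangian at `T` is at least `∫ g dμ + ∫ g⋆ dν ≥ V`. The minimax lemma
`exists_forall_le_of_forall_weights` turns this into one `T` at which each of the finitely many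
Lagrangians is almost `V`. The Lagrangian of `‖·‖²` confines such `T` to a ball of `L²(ν)`, and weak
compactness (`nonempty_iInter_of_closed_convex_bounded`) gives a single `T` for all `f`. Replacing
`f` by `t f`, with `t = 0` and `t` large, splits the result into `V ≤ ∫ ⟨T y, y⟩ dν` and `T#ν ⪯_F
μ`.

Expanding `½‖x - y‖²` now gives the duality formula, and `W_{2,F} = 0` forces the optimal `T` to be
the identity `ν`-a.e. If `T x ∈ ∂f(x)` with `f ∈ F`, Fenchel's equality bounds `V` for the pair `(μ,
T#μ)` by `∫ ⟨x, T x⟩ dμ`, which is the embedding. In general `μ` is moved to `T#μ` and then to `ν`;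
the first leg is estimated by testing Fenchel's equality against the optimal map of the pair `(μ,
ν)` (`lintegral_subgradient_map_le`). -/

namespace ConicOT

/-- `eintegral` over an arbitrary measurable space. -/
noncomputable def eint {α : Type*} [MeasurableSpace α] (μ : Measure α) (f : α → EReal) : EReal :=
  ((∫⁻ x, (f x).toENNReal ∂μ : ℝ≥0∞) : EReal) - ((∫⁻ x, (-f x).toENNReal ∂μ : ℝ≥0∞) : EReal)

theorem eintegral_eq_eint {d : ℕ} (μ : Measure (Space d)) (f : EFun d) :
    eintegral μ f = eint μ f := rfl

/-! ### Extended-valued integrals with an integrable minorant -/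

section eint

variable {α : Type*} [MeasurableSpace α] {μ : Measure α}

theorem eint_mono_ae {f g : α → EReal} (h : ∀ᵐ x ∂μ, f x ≤ g x) : eint μ f ≤ eint μ g := by
  refine EReal.sub_le_sub ?_ ?_
  · refine EReal.coe_ennreal_le_coe_ennreal_iff.2 (lintegral_mono_ae ?_)
    filter_upwards [h] with x hx using EReal.toENNReal_le_toENNReal hx
  · refine EReal.coe_ennreal_le_coe_ennreal_iff.2 (lintegral_mono_ae ?_)
    filter_upwards [h] with x hx using EReal.toENNReal_le_toENNReal (EReal.neg_le_neg_iff.2 hx)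

theorem eint_congr_ae {f g : α → EReal} (h : ∀ᵐ x ∂μ, f x = g x) : eint μ f = eint μ g :=
  le_antisymm (eint_mono_ae (h.mono fun _ hx => hx.le)) (eint_mono_ae (h.mono fun _ hx => hx.ge))

theorem eint_coe {g : α → ℝ} (hg : Integrable g μ) :
    eint μ (fun x => (g x : EReal)) = ((∫ x, g x ∂μ : ℝ) : EReal) := by
  have h1 := hg.lintegral_lt_top.ne
  have h2 := hg.neg.lintegral_lt_top.ne
  simp only [Pi.neg_apply] at h2
  rw [integral_eq_lintegral_pos_part_sub_lintegral_neg_part hg, eint, EReal.coe_sub,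
    EReal.coe_ennreal_toReal h1, EReal.coe_ennreal_toReal h2]
  simp only [← EReal.coe_neg, EReal.toENNReal_of_ne_top (EReal.coe_ne_top _), EReal.toReal_coe]

theorem eint_map {β : Type*} [MeasurableSpace β] {T : α → β} (hT : AEMeasurable T μ)
    {f : β → EReal} (hf : Measurable f) : eint (μ.map T) f = eint μ (fun x => f (T x)) := by
  rw [eint, eint, lintegral_map' (by fun_prop) hT, lintegral_map' _ hT]
  exact (hf.neg.ereal_toENNReal).aemeasurable

/-- This is `a = (a - b) + b` split into positive and negative parts, with no subtraction between
parts, so that it can be integrated in `[0, ∞]`. -/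
theorem toENNReal_add_identity {a : EReal} {b : ℝ} (h : (b : EReal) ≤ a) :
    a.toENNReal + (-(b : EReal)).toENNReal =
      (a - b).toENNReal + ((-a).toENNReal + (b : EReal).toENNReal) := by
  induction a with
  | bot => simp at h
  | top => simp
  | coe a =>
    have h' : b ≤ a := by exact_mod_cast h
    rw [← EReal.coe_neg, ← EReal.coe_neg, ← EReal.coe_sub]
    simp only [EReal.toENNReal_of_ne_top (EReal.coe_ne_top _), EReal.toReal_coe]
    rcases le_total 0 a with ha | ha <;> rcases le_total 0 b with hb | hb
    · rw [ENNReal.ofReal_of_nonpos (p := -b) (by linarith),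
        ENNReal.ofReal_of_nonpos (p := -a) (by linarith), zero_add, add_zero,
        ← ENNReal.ofReal_add (by linarith) hb]
      ring_nf
    · rw [ENNReal.ofReal_of_nonpos (p := -a) (by linarith), ENNReal.ofReal_of_nonpos hb,
        ← ENNReal.ofReal_add ha (by linarith)]
      simp [sub_eq_add_neg]
    · have : a = 0 := by linarith
      have : b = 0 := by linarith
      subst_vars; simp
    · rw [ENNReal.ofReal_of_nonpos ha, ENNReal.ofReal_of_nonpos hb, zero_add, add_zero,
        ← ENNReal.ofReal_add (by linarith) (by linarith)]
      ring_nf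

/-- Subtracting an integrable minorant leaves a nonnegative integrand, so the theory of `lintegral`
(finiteness a.e., Fatou) applies to `f`. -/
theorem eint_eq_lintegral_add {f : α → EReal} {g : α → ℝ} (hf : AEMeasurable f μ)
    (hg : Integrable g μ) (hgf : ∀ᵐ x ∂μ, (g x : EReal) ≤ f x) :
    eint μ f = ((∫⁻ x, (f x - g x).toENNReal ∂μ : ℝ≥0∞) : EReal) + ((∫ x, g x ∂μ : ℝ) : EReal) := by
  have hgm : AEMeasurable (fun x => (g x : EReal)) μ := hg.aemeasurable.coe_real_ereal
  have key : (∫⁻ x, (f x).toENNReal ∂μ) + ∫⁻ x, (-(g x : EReal)).toENNReal ∂μ =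
      (∫⁻ x, (f x - g x).toENNReal ∂μ) +
        ((∫⁻ x, (-f x).toENNReal ∂μ) + ∫⁻ x, (g x : EReal).toENNReal ∂μ) := by
    rw [← lintegral_add_left' hf.ereal_toENNReal, ← lintegral_add_right' _ hgm.ereal_toENNReal,
      ← lintegral_add_right' (fun x => (f x - g x).toENNReal)
        (g := fun x => (-f x).toENNReal + (g x : EReal).toENNReal)
        (hf.neg.ereal_toENNReal.add hgm.ereal_toENNReal)]
    exact lintegral_congr_ae (hgf.mono fun x hx => toENNReal_add_identity hx)
  have hR : ∫⁻ x, (-(g x : EReal)).toENNReal ∂μ ≠ ⊤ := by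
    simpa [← EReal.coe_neg] using hg.neg.lintegral_lt_top.ne
  have hQ : ∫⁻ x, (g x : EReal).toENNReal ∂μ ≠ ⊤ := by
    simpa using hg.lintegral_lt_top.ne
  have hN : ∫⁻ x, (-f x).toENNReal ∂μ ≠ ⊤ := by
    refine ne_top_of_le_ne_top hR (lintegral_mono_ae ?_)
    filter_upwards [hgf] with x hx using EReal.toENNReal_le_toENNReal (EReal.neg_le_neg_iff.2 hx)
  rw [← eint_coe hg, eint, eint]
  generalize (∫⁻ x, (f x).toENNReal ∂μ) = P at *
  generalize (∫⁻ x, (f x - g x).toENNReal ∂μ) = D at *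
  generalize (∫⁻ x, (-(g x : EReal)).toENNReal ∂μ) = R at *
  generalize (∫⁻ x, (g x : EReal).toENNReal ∂μ) = Q at *
  generalize (∫⁻ x, (-f x).toENNReal ∂μ) = N at *
  lift R to NNReal using hR
  lift Q to NNReal using hQ
  lift N to NNReal using hN
  by_cases hD : D = ⊤
  · have hP : P = ⊤ := by
      by_contra h
      lift P to NNReal using h
      rw [hD] at key
      simp at key
    subst hD hP
    rfl
  · have hP : P ≠ ⊤ := by
      intro h
      lift D to NNReal using hD
      rw [h] at key
      simp only [top_add] at key
      exact absurd key.symm (by simp [← ENNReal.coe_add])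
    lift D to NNReal using hD
    lift P to NNReal using hP
    have key' : (P : ℝ) + R = D + (N + Q) := by exact_mod_cast key
    change ((P : ℝ) : EReal) - ((N : ℝ) : EReal) = ((D : ℝ) : EReal) + (((Q : ℝ) : EReal) - ((R : ℝ) : EReal))
    norm_cast
    linarith

variable {f : α → EReal} {g : α → ℝ}

theorem eint_ne_bot (hg : Integrable g μ)
    (hgf : ∀ᵐ x ∂μ, (g x : EReal) ≤ f x) : eint μ f ≠ ⊥ := by
  refine ne_bot_of_le_ne_bot (EReal.coe_ne_bot (∫ x, g x ∂μ)) ?_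
  rw [← eint_coe hg]
  exact eint_mono_ae hgf

theorem ae_ne_top_of_eint_ne_top (hf : AEMeasurable f μ) (hg : Integrable g μ)
    (hgf : ∀ᵐ x ∂μ, (g x : EReal) ≤ f x) (h : eint μ f ≠ ⊤) : ∀ᵐ x ∂μ, f x ≠ ⊤ := by
  rw [eint_eq_lintegral_add hf hg hgf] at h
  have h' : ∫⁻ x, (f x - g x).toENNReal ∂μ ≠ ⊤ := by
    intro h'
    rw [h'] at h
    simp at h
  have := ae_lt_top' (hf.sub (hg.aemeasurable.coe_real_ereal)).ereal_toENNReal h'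
  filter_upwards [this] with x hx hx'
  simp [hx'] at hx

theorem integrable_toReal_of_eint_ne_top (hf : AEMeasurable f μ) (hg : Integrable g μ)
    (hgf : ∀ᵐ x ∂μ, (g x : EReal) ≤ f x) (h : eint μ f ≠ ⊤) :
    Integrable (fun x => (f x).toReal) μ := by
  have htop := ae_ne_top_of_eint_ne_top hf hg hgf h
  rw [eint_eq_lintegral_add hf hg hgf] at h
  have h' : ∫⁻ x, (f x - g x).toENNReal ∂μ ≠ ⊤ := by
    intro h'
    rw [h'] at h
    simp at h
  have hm := (hf.sub (hg.aemeasurable.coe_real_ereal)).ereal_toENNReal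
  refine ((integrable_toReal_of_lintegral_ne_top hm h').add hg).congr ?_
  filter_upwards [htop, hgf] with x hx hx'
  have hb : f x ≠ ⊥ := ne_bot_of_le_ne_bot (EReal.coe_ne_bot _) hx'
  simp only [Pi.add_apply, Pi.sub_apply]
  lift f x to ℝ using ⟨hx, hb⟩ with a
  have : g x ≤ a := by exact_mod_cast hx'
  rw [← EReal.coe_sub, EReal.toENNReal_of_ne_top (EReal.coe_ne_top _), EReal.toReal_coe,
    ENNReal.toReal_ofReal (by linarith)]
  simp

theorem eint_eq_integral_toReal (hf : AEMeasurable f μ) (hg : Integrable g μ)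
    (hgf : ∀ᵐ x ∂μ, (g x : EReal) ≤ f x) (h : eint μ f ≠ ⊤) :
    eint μ f = ((∫ x, (f x).toReal ∂μ : ℝ) : EReal) := by
  rw [← eint_coe (integrable_toReal_of_eint_ne_top hf hg hgf h)]
  refine eint_congr_ae ?_
  filter_upwards [ae_ne_top_of_eint_ne_top hf hg hgf h, hgf] with x hx hx'
  exact (EReal.coe_toReal hx (ne_bot_of_le_ne_bot (EReal.coe_ne_bot _) hx')).symm

end eint

/-! ### Affine minorants, conjugates and proximal maps -/

section cvx

variable {d : ℕ} {f : EFun d}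

theorem measurable_of_mem_cvx (hf : f ∈ cvx d) : Measurable f := hf.1.measurable

theorem coe_toReal_of_mem_cvx (hf : f ∈ cvx d) {x : Space d} (hx : f x ≠ ⊤) :
    ((f x).toReal : EReal) = f x := EReal.coe_toReal hx (hf.2.2.1 x)

theorem le_convex_combination (hf : f ∈ cvx d) {x y : Space d} (hx : f x ≠ ⊤) (hy : f y ≠ ⊤)
    {a b : ℝ} (ha : 0 ≤ a) (hb : 0 ≤ b) (hab : a + b = 1) :
    f (a • x + b • y) ≤ ((a * (f x).toReal + b * (f y).toReal : ℝ) : EReal) := by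
  have h1 : (x, (f x).toReal) ∈ {p : Space d × ℝ | f p.1 ≤ (p.2 : EReal)} :=
    (coe_toReal_of_mem_cvx hf hx).ge
  have h2 : (y, (f y).toReal) ∈ {p : Space d × ℝ | f p.1 ≤ (p.2 : EReal)} :=
    (coe_toReal_of_mem_cvx hf hy).ge
  exact hf.2.1 h1 h2 ha hb hab

theorem isClosed_epigraph_of_mem_cvx (hf : f ∈ cvx d) :
    IsClosed {p : Space d × ℝ | f p.1 ≤ (p.2 : EReal)} :=
  hf.1.isClosed_epigraph.preimage
    (continuous_fst.prodMk (continuous_coe_real_ereal.comp continuous_snd))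

/-- A hyperplane separates the closed convex epigraph from a point one unit below its boundary, and
it cannot be vertical. -/
theorem exists_affine_le (hf : f ∈ cvx d) :
    ∃ (a : Space d) (b : ℝ), ∀ x, ((inner ℝ x a + b : ℝ) : EReal) ≤ f x := by
  obtain ⟨x₀, hx₀⟩ := hf.2.2.2
  have hr := coe_toReal_of_mem_cvx hf hx₀
  set r := (f x₀).toReal
  have hp : ((x₀, r - 1) : Space d × ℝ) ∉ {p : Space d × ℝ | f p.1 ≤ (p.2 : EReal)} := by
    simp only [Set.mem_ofPred_eq, ← hr, not_le]
    exact_mod_cast sub_one_lt r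
  obtain ⟨φ, u, h1, h2⟩ :=
    geometric_hahn_banach_point_closed hf.2.1 (isClosed_epigraph_of_mem_cvx hf) hp
  have hφ : ∀ x t, φ (x, t) = φ (x, 0) + t * φ (0, 1) := fun x t => by
    rw [← smul_eq_mul, ← map_smul, ← map_add]; simp
  set s := φ (0, 1)
  have h3 := h2 (x₀, r) hr.ge
  rw [hφ] at h1 h3
  -- The points `(x₀, r - 1)` and `(x₀, r)` lie strictly on opposite sides, so the vertical slope is
  -- positive.
  have hs : 0 < s := by nlinarith
  set l : StrongDual ℝ (Space d) := φ.comp (ContinuousLinearMap.inl ℝ (Space d) ℝ)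
  set v := (InnerProductSpace.toDual ℝ (Space d)).symm l
  have hv : ∀ x, inner ℝ x v = φ (x, 0) := fun x => by
    rw [real_inner_comm, InnerProductSpace.toDual_symm_apply]; rfl
  refine ⟨(-s⁻¹) • v, u / s, fun x => ?_⟩
  by_cases hx : f x = ⊤
  · simp [hx]
  have h4 := h2 (x, (f x).toReal) (coe_toReal_of_mem_cvx hf hx).ge
  rw [hφ] at h4
  rw [← coe_toReal_of_mem_cvx hf hx, EReal.coe_le_coe_iff, inner_smul_right, hv]
  have : -s⁻¹ * φ (x, 0) + u / s = (u - φ (x, 0)) / s := by field_simp; ring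
  rw [this, div_le_iff₀ hs]
  linarith

theorem measurable_conjugate (f : EFun d) : Measurable (conjugate f) := by
  refine LowerSemicontinuous.measurable ?_
  refine lowerSemicontinuous_iSup fun x => Continuous.lowerSemicontinuous ?_
  generalize f x = c
  induction c with
  | bot => simpa using continuous_const
  | top => simpa using continuous_const
  | coe c =>
    simp only [← EReal.coe_sub]
    exact continuous_coe_real_ereal.comp (by fun_prop)

theorem inner_sub_le_conjugate (f : EFun d) (x y : Space d) :
    ((inner ℝ x y : ℝ) : EReal) - f x ≤ conjugate f y :=
  le_iSup (fun x => ((inner ℝ x y : ℝ) : EReal) - f x) x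

theorem exists_affine_le_conjugate (hf : f ∈ cvx d) :
    ∃ (a : Space d) (b : ℝ), ∀ y, ((inner ℝ y a + b : ℝ) : EReal) ≤ conjugate f y := by
  obtain ⟨x₀, hx₀⟩ := hf.2.2.2
  refine ⟨x₀, -(f x₀).toReal, fun y => ?_⟩
  refine le_trans (le_of_eq ?_) (inner_sub_le_conjugate f x₀ y)
  rw [← coe_toReal_of_mem_cvx hf hx₀, real_inner_comm]
  norm_cast

theorem inner_le_add_conjugate {x y : Space d} (hx : f x ≠ ⊤) (hx' : f x ≠ ⊥)
    (hy : conjugate f y ≠ ⊤) :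
    inner ℝ x y ≤ (f x).toReal + (conjugate f y).toReal := by
  have h := inner_sub_le_conjugate f x y
  lift f x to ℝ using ⟨hx, hx'⟩ with a
  have hb : conjugate f y ≠ ⊥ := ne_bot_of_le_ne_bot (EReal.coe_ne_bot (inner ℝ x y - a)) h
  lift conjugate f y to ℝ using ⟨hy, hb⟩ with b
  have : inner ℝ x y - a ≤ b := by exact_mod_cast h
  simp only [EReal.toReal_coe]
  linarith

theorem exists_proximal_point (hf : f ∈ cvx d) {δ : ℝ} (hδ : 0 < δ) (y : Space d) :
    ∃ p, f p ≠ ⊤ ∧ ∀ x, f x ≠ ⊤ → (f p).toReal + δ * ‖p‖ ^ 2 - inner ℝ p y ≤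
      (f x).toReal + δ * ‖x‖ ^ 2 - inner ℝ x y := by
  obtain ⟨x₀, hx₀⟩ := hf.2.2.2
  obtain ⟨a, b, hab⟩ := exists_affine_le hf
  set q : Space d → ℝ := fun x => δ * ‖x‖ ^ 2 - inner ℝ x y
  have hq : Continuous q := by fun_prop
  have hlsc : LowerSemicontinuous fun x => f x + (q x : EReal) :=
    hf.1.add' (continuous_coe_real_ereal.comp hq).lowerSemicontinuous fun x =>
      EReal.continuousAt_add (Or.inr (EReal.coe_ne_bot _)) (Or.inr (EReal.coe_ne_top _))
  set c := (f x₀).toReal + q x₀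
  set K := |c - b| + 1
  -- Outside this ball the affine minorant gives a value at least `‖x‖ (δ‖x‖ - ‖a - y‖) + b ≥ K + b
  -- ≥ c`, so a minimiser over the ball is global.
  set R := max ‖x₀‖ (max 1 ((‖a - y‖ + K) / δ))
  obtain ⟨p, hpR, hp⟩ := (hlsc.lowerSemicontinuousOn (Metric.closedBall 0 R)).exists_isMinOn
    ⟨x₀, by simp [R]⟩ (isCompact_closedBall (0 : Space d) R)
  have hp₀ : f p + q p ≤ c := by
    have := hp (show x₀ ∈ Metric.closedBall 0 R by simp [R])
    simp only [Set.mem_ofPred_eq] at this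
    rw [← coe_toReal_of_mem_cvx hf hx₀] at this
    exact_mod_cast this
  have hpt : f p ≠ ⊤ := by
    intro h
    rw [h, EReal.top_add_coe] at hp₀
    exact absurd hp₀ (by simp)
  refine ⟨p, hpt, fun x hx => ?_⟩
  suffices (f p).toReal + q p ≤ (f x).toReal + q x by simp only [q] at this; linarith
  by_cases hxR : ‖x‖ ≤ R
  · have := hp (show x ∈ Metric.closedBall 0 R by simpa using hxR)
    simp only [Set.mem_ofPred_eq] at this
    rw [← coe_toReal_of_mem_cvx hf hx, ← coe_toReal_of_mem_cvx hf hpt] at this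
    exact_mod_cast this
  · have h1 : (f p).toReal + q p ≤ c := by
      rw [← coe_toReal_of_mem_cvx hf hpt] at hp₀
      exact_mod_cast hp₀
    refine h1.trans ?_
    have h2 : inner ℝ x a + b ≤ (f x).toReal := by
      have := hab x
      rw [← coe_toReal_of_mem_cvx hf hx] at this
      exact_mod_cast this
    push Not at hxR
    have hx1 : 1 < ‖x‖ := lt_of_le_of_lt ((le_max_left _ _).trans (le_max_right _ _)) hxR
    have hx2 : (‖a - y‖ + K) / δ < ‖x‖ :=
      lt_of_le_of_lt ((le_max_right _ _).trans (le_max_right _ _)) hxR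
    rw [div_lt_iff₀ hδ] at hx2
    have h3 : -(‖x‖ * ‖a - y‖) ≤ inner ℝ x (a - y) := (abs_le.1 (abs_real_inner_le_norm _ _)).1
    rw [inner_sub_right] at h3
    have hK : c - b ≤ K := (le_abs_self _).trans (by simp [K])
    have hK0 : 0 < K := by positivity
    have h4 : ‖x‖ * (‖a - y‖ + K) ≤ ‖x‖ * (‖x‖ * δ) := by gcongr
    simp only [q]
    nlinarith

/-- The proximal map: for `f ∈ cvx d` and `δ > 0`, the gradient of the conjugate of
`f + δ‖·‖²` is defined everywhere and Lipschitz. -/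
theorem exists_proximal_map (hf : f ∈ cvx d) {δ : ℝ} (hδ : 0 < δ) :
    ∃ T : Space d → Space d, (∀ y z, ‖T y - T z‖ ≤ δ⁻¹ * ‖y - z‖) ∧ ∀ y, f (T y) ≠ ⊤ ∧
      ∀ x, f x ≠ ⊤ → (f (T y)).toReal + δ * ‖T y‖ ^ 2 - inner ℝ (T y) y ≤
        (f x).toReal + δ * ‖x‖ ^ 2 - inner ℝ x y := by
  choose T hT using exists_proximal_point hf hδ
  refine ⟨T, fun y z => ?_, hT⟩
  -- The midpoint of `T y` and `T z` is the competitor. Adding the inequality to its mirror image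
  -- cancels the values of `f` and leaves `δ‖T y - T z‖² ≤ ⟨T y - T z, y - z⟩`.
  have key : ∀ y z, 0 ≤ (f (T z)).toReal - (f (T y)).toReal + 2 * δ * inner ℝ (T y) (T z - T y)
      + δ / 2 * ‖T z - T y‖ ^ 2 - inner ℝ (T z - T y) y := by
    intro y z
    have hc := le_convex_combination hf (hT y).1 (hT z).1 (a := 1 / 2) (b := 1 / 2)
      (by norm_num) (by norm_num) (by norm_num)
    set m := (1 / 2 : ℝ) • T y + (1 / 2 : ℝ) • T z
    have hm : f m ≠ ⊤ := ne_top_of_le_ne_top (EReal.coe_ne_top _) hc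
    rw [← coe_toReal_of_mem_cvx hf hm, EReal.coe_le_coe_iff] at hc
    have h := (hT y).2 m hm
    have e : m = T y + (1 / 2 : ℝ) • (T z - T y) := by simp only [m]; module
    rw [e] at h hc
    rw [inner_add_left, inner_smul_left, norm_add_sq_real, inner_smul_right, norm_smul] at h
    simp at h hc
    nlinarith
  have h1 := key y z
  have h2 := key z y
  have e1 : inner ℝ (T y) (T z - T y) + inner ℝ (T z) (T y - T z) = - ‖T y - T z‖ ^ 2 := by
    rw [← real_inner_self_eq_norm_sq]
    simp only [inner_sub_left, inner_sub_right]
    ring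
  have e2 : inner ℝ (T z - T y) y + inner ℝ (T y - T z) z = - inner ℝ (T y - T z) (y - z) := by
    simp only [inner_sub_left, inner_sub_right]
    ring
  have e3 : ‖T z - T y‖ = ‖T y - T z‖ := norm_sub_rev _ _
  rw [e3] at h1
  have h3 : δ * ‖T y - T z‖ ^ 2 ≤ inner ℝ (T y - T z) (y - z) := by nlinarith
  have h4 := real_inner_le_norm (T y - T z) (y - z)
  rw [le_inv_mul_iff₀ hδ]
  rcases (norm_nonneg (T y - T z)).eq_or_lt with h0 | h0
  · rw [← h0, mul_zero]; positivity
  · nlinarith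

end cvx

/-! ### Weak compactness and a finite minimax inequality -/

/-- In a real Hilbert space, closed convex sets with the finite intersection property within a ball
have a common point. -/
theorem nonempty_iInter_of_closed_convex_bounded {H ι : Type*} [NormedAddCommGroup H]
    [InnerProductSpace ℝ H] [CompleteSpace H] (K : ι → Set H) (hc : ∀ i, IsClosed (K i))
    (hK : ∀ i, Convex ℝ (K i)) (R : ℝ)
    (hfin : ∀ u : Finset ι, ∃ x, ‖x‖ ≤ R ∧ ∀ i ∈ u, x ∈ K i) : ∃ x, ∀ i, x ∈ K i := by
  let Φ : WeakDual ℝ H → H := fun φ =>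
    (InnerProductSpace.toDual ℝ H).symm (WeakDual.toStrongDual φ)
  let Ψ : H → WeakDual ℝ H := fun x => StrongDual.toWeakDual (InnerProductSpace.toDual ℝ H x)
  have hΦΨ : ∀ x, Φ (Ψ x) = x := fun x => by simp [Φ, Ψ]
  -- Closed convex sets are weakly closed: a separating functional is evaluation at a vector by
  -- Riesz, so it is weak-* continuous. Banach-Alaoglu then applies.
  have hcl : ∀ i, IsClosed (Φ ⁻¹' K i) := by
    intro i
    refine isOpen_compl_iff.1 (isOpen_iff_mem_nhds.2 fun φ hφ => ?_)
    obtain ⟨l, u, h1, h2⟩ := geometric_hahn_banach_point_closed (hK i) (hc i) hφ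
    set v := (InnerProductSpace.toDual ℝ H).symm l
    have hl : ∀ ψ : WeakDual ℝ H, l (Φ ψ) = ψ v := fun ψ => by
      have e1 : l (Φ ψ) = inner ℝ v (Φ ψ) := (InnerProductSpace.toDual_symm_apply).symm
      have e2 : inner ℝ (Φ ψ) v = ψ v := InnerProductSpace.toDual_symm_apply
      rw [e1, real_inner_comm, e2]
    have ho : IsOpen {ψ : WeakDual ℝ H | ψ v < u} :=
      isOpen_Iio.preimage (WeakDual.eval_continuous v)
    refine Filter.mem_of_superset (ho.mem_nhds (by simpa [← hl] using h1)) fun ψ hψ hψ' => ?_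
    have := h2 _ hψ'
    rw [hl] at this
    exact lt_asymm this hψ
  obtain ⟨φ, -, hφ⟩ := (WeakDual.isCompact_closedBall (𝕜 := ℝ) (E := H) 0 R).inter_iInter_nonempty
    (fun i => Φ ⁻¹' K i) hcl fun u => by
      obtain ⟨x, hx, hxu⟩ := hfin u
      refine ⟨Ψ x, ?_, ?_⟩
      · simpa [Ψ] using hx
      · simpa [hΦΨ] using hxu
  exact ⟨Φ φ, fun i => by simpa using Set.mem_iInter.1 hφ i⟩

/-- A minimax inequality for finitely many concave functions, where only strictly positive weights
are available. -/
theorem exists_forall_le_of_forall_weights {E ι : Type*} [AddCommGroup E] [Module ℝ E] [Fintype ι]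
    [Nonempty ι] {D : Set E} {L : ι → E → ℝ} (hL : ∀ i, ConcaveOn ℝ D (L i)) {V : ℝ}
    (h : ∀ w : ι → ℝ, (∀ i, 0 < w i) → ∑ i, w i = 1 →
      ∃ T ∈ D, V ≤ ∑ i, w i * L i T ∧ ∀ S ∈ D, ∑ i, w i * L i S ≤ ∑ i, w i * L i T)
    {c : ℝ} (hc : c < V) : ∃ T ∈ D, ∀ i, c ≤ L i T := by
  classical
  have hcard : (0 : ℝ) < Fintype.card ι := by exact_mod_cast Fintype.card_pos
  -- The uniform average attains its maximum `C`; this finite bound is what allows uniform weights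
  -- to be mixed in below.
  obtain ⟨T₁, hT₁, -, hmax⟩ := h (fun _ => (Fintype.card ι : ℝ)⁻¹) (fun _ => by positivity)
    (by simp [hcard.ne'])
  set C := ∑ i, (Fintype.card ι : ℝ)⁻¹ * L i T₁
  -- Strict inequalities make `A` open, concavity makes it convex, and it is closed under lowering
  -- coordinates. If the constant vector `c` is outside `A`, a separating functional supplies the
  -- weights.
  let A : Set (ι → ℝ) := {v | ∃ T ∈ D, ∀ i, v i < L i T}
  have hAo : IsOpen A := by
    have : A = ⋃ T ∈ D, Set.pi Set.univ fun i => Set.Iio (L i T) := by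
      ext v; simp [A, Set.mem_pi]
    rw [this]
    exact isOpen_biUnion fun T _ => isOpen_set_pi Set.finite_univ fun _ _ => isOpen_Iio
  have hAc : Convex ℝ A := by
    rintro v ⟨T, hT, hv⟩ v' ⟨T', hT', hv'⟩ a b ha hb hab
    refine ⟨a • T + b • T', (hL (Classical.arbitrary ι)).1 hT hT' ha hb hab, fun i => ?_⟩
    refine lt_of_lt_of_le ?_ ((hL i).2 hT hT' ha hb hab)
    simp only [Pi.add_apply, Pi.smul_apply, smul_eq_mul]
    rcases ha.eq_or_lt with rfl | ha
    · have : b = 1 := by linarith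
      subst this; simpa using hv' i
    · have h1 := mul_lt_mul_of_pos_left (hv i) ha
      have h2 := mul_le_mul_of_nonneg_left (hv' i).le hb
      linarith
  by_cases hcA : (fun _ => c) ∈ A
  · obtain ⟨T, hT, hv⟩ := hcA
    exact ⟨T, hT, fun i => (hv i).le⟩
  exfalso
  obtain ⟨φ, hφ⟩ := geometric_hahn_banach_open_point hAc hAo hcA
  set w : ι → ℝ := fun i => φ (Pi.single i 1)
  have hφw : ∀ v, φ v = ∑ i, w i * v i := fun v => by
    conv_lhs => rw [pi_eq_sum_univ' v]
    simp only [map_sum, map_smul, smul_eq_mul, w]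
    refine Finset.sum_congr rfl fun i _ => ?_
    rw [mul_comm]
  have hv₁ : (fun i => L i T₁ - 1) ∈ A := ⟨T₁, hT₁, fun i => by simp⟩
  have hw0 : ∀ i, 0 ≤ w i := by
    intro i
    by_contra hneg
    push Not at hneg
    -- If `w i` were negative, lowering coordinate `i` by this `t` would stay in `A` and push `φ` up
    -- to its bound.
    set t := |φ (fun _ => c) - φ (fun i => L i T₁ - 1)| / (-w i)
    have ht : 0 ≤ t := div_nonneg (abs_nonneg _) (by linarith)
    have hmem : (fun i => L i T₁ - 1) - t • (Pi.single i 1 : ι → ℝ) ∈ A := by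
      refine ⟨T₁, hT₁, fun j => ?_⟩
      have : 0 ≤ (Pi.single i 1 : ι → ℝ) j := by
        rw [Pi.single_apply]; split_ifs <;> simp
      simp only [Pi.sub_apply, Pi.smul_apply, smul_eq_mul]
      nlinarith
    have h1 := hφ _ hmem
    rw [map_sub, map_smul, smul_eq_mul] at h1
    have h2 : t * w i = -|φ (fun _ => c) - φ (fun i => L i T₁ - 1)| := by
      simp only [t]; rw [div_neg, neg_mul, div_mul_cancel₀ _ hneg.ne]
    have h3 := le_abs_self (φ (fun _ => c) - φ (fun i => L i T₁ - 1))
    change _ - t * w i < _ at h1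
    linarith
  set s := ∑ i, w i
  have hs : 0 < s := by
    refine (Finset.sum_nonneg fun i _ => hw0 i).lt_of_ne fun h0 => ?_
    have hz := (Finset.sum_eq_zero_iff_of_nonneg fun i _ => hw0 i).1 h0.symm
    have h1 := hφ _ hv₁
    rw [hφw, hφw, Finset.sum_eq_zero fun i hi => by rw [hz i hi, zero_mul],
      Finset.sum_eq_zero fun i hi => by rw [hz i hi, zero_mul]] at h1
    exact lt_irrefl _ h1
  have hwL : ∀ T ∈ D, ∑ i, w i * L i T ≤ s * c := by
    intro T hT
    refine le_of_forall_pos_le_add fun ε hε => ?_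
    have h1 := hφ (fun i => L i T - ε / s) ⟨T, hT, fun i => by simp; positivity⟩
    rw [hφw, hφw, ← Finset.sum_mul] at h1
    simp only [mul_sub, Finset.sum_sub_distrib, ← Finset.sum_mul] at h1
    rw [mul_div_cancel₀ _ hs.ne'] at h1
    linarith
  -- The separating weights may vanish. Mixing in a share `θ` of uniform weights makes them
  -- positive, and `θ` is so small that the bound stays below `V`.
  obtain ⟨θ, hθ0, hθ1, hθ⟩ : ∃ θ : ℝ, 0 < θ ∧ θ < 1 ∧ (1 - θ) * c + θ * C < V := by
    have hB : 0 < |C - c| + (V - c) := by have := abs_nonneg (C - c); linarith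
    refine ⟨(V - c) / (2 * (|C - c| + (V - c))), by apply div_pos <;> linarith, ?_, ?_⟩
    · rw [div_lt_one (by linarith)]
      have := abs_nonneg (C - c); linarith
    · set θ := (V - c) / (2 * (|C - c| + (V - c)))
      have e : θ * (|C - c| + (V - c)) = (V - c) / 2 := by
        simp only [θ]; field_simp
      have hθ0 : 0 < θ := by apply div_pos <;> linarith
      have := le_abs_self (C - c)
      nlinarith
  obtain ⟨T, hT, hV, -⟩ := h (fun i => (1 - θ) * (w i / s) + θ * (Fintype.card ι : ℝ)⁻¹)
    (fun i => by
      have h1 : 0 ≤ (1 - θ) * (w i / s) :=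
        mul_nonneg (by linarith) (div_nonneg (hw0 i) hs.le)
      have h2 : 0 < θ * (Fintype.card ι : ℝ)⁻¹ := by positivity
      linarith) (by
      rw [Finset.sum_add_distrib, ← Finset.mul_sum, ← Finset.sum_div]
      simp only [Finset.sum_const, Finset.card_univ, nsmul_eq_mul]
      field_simp
      ring)
  have e : ∑ i, ((1 - θ) * (w i / s) + θ * (Fintype.card ι : ℝ)⁻¹) * L i T =
      (1 - θ) * ((∑ i, w i * L i T) / s) + θ * ∑ i, (Fintype.card ι : ℝ)⁻¹ * L i T := by
    rw [Finset.sum_div, Finset.mul_sum, Finset.mul_sum, ← Finset.sum_add_distrib]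
    exact Finset.sum_congr rfl fun i _ => by ring
  rw [e] at hV
  have h1 : (∑ i, w i * L i T) / s ≤ c := by
    rw [div_le_iff₀ hs, mul_comm]; exact hwL T hT
  have h2 := hmax T hT
  nlinarith

/-! ### The functional `T ↦ ∫ f(T) dν` on `L²(ν)` -/

section composition

variable {d : ℕ} {α : Type*} [MeasurableSpace α] {ν : Measure α}

theorem integrable_inner {E : Type*} [NormedAddCommGroup E] [InnerProductSpace ℝ E] {S T : α → E}
    (hS : MemLp S 2 ν) (hT : MemLp T 2 ν) : Integrable (fun y => (inner ℝ (S y) (T y) : ℝ)) ν := by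
  refine (L2.integrable_inner (𝕜 := ℝ) hS.toLp hT.toLp).congr ?_
  filter_upwards [hS.coeFn_toLp, hT.coeFn_toLp] with y h1 h2
  rw [h1, h2]

theorem inner_toLp {E : Type*} [NormedAddCommGroup E] [InnerProductSpace ℝ E] (T : Lp E 2 ν)
    {S : α → E} (hS : MemLp S 2 ν) : inner ℝ T hS.toLp = ∫ y, (inner ℝ (T y) (S y) : ℝ) ∂ν := by
  rw [L2.inner_def]
  refine integral_congr_ae ?_
  filter_upwards [hS.coeFn_toLp] with y h
  rw [h]

variable {f : EFun d} {T : α → Space d}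

theorem aemeasurable_comp (hf : f ∈ cvx d) (hT : MemLp T 2 ν) :
    AEMeasurable (fun y => f (T y)) ν :=
  (measurable_of_mem_cvx hf).comp_aemeasurable hT.1.aemeasurable

variable [IsFiniteMeasure ν]

theorem integrable_affine (hT : MemLp T 2 ν) (a : Space d) (b : ℝ) :
    Integrable (fun y => (inner ℝ (T y) a + b : ℝ)) ν :=
  (integrable_inner hT (memLp_const a)).add (integrable_const b)

theorem eint_comp_ne_bot (hf : f ∈ cvx d) (hT : MemLp T 2 ν) :
    eint ν (fun y => f (T y)) ≠ ⊥ := by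
  obtain ⟨a, b, hab⟩ := exists_affine_le hf
  exact eint_ne_bot (integrable_affine hT a b) (Filter.Eventually.of_forall fun y => hab (T y))

theorem ae_comp_ne_top (hf : f ∈ cvx d) (hT : MemLp T 2 ν)
    (h : eint ν (fun y => f (T y)) ≠ ⊤) : ∀ᵐ y ∂ν, f (T y) ≠ ⊤ := by
  obtain ⟨a, b, hab⟩ := exists_affine_le hf
  exact ae_ne_top_of_eint_ne_top (aemeasurable_comp hf hT) (integrable_affine hT a b)
    (Filter.Eventually.of_forall fun y => hab (T y)) h

theorem integrable_toReal_comp (hf : f ∈ cvx d) (hT : MemLp T 2 ν)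
    (h : eint ν (fun y => f (T y)) ≠ ⊤) : Integrable (fun y => (f (T y)).toReal) ν := by
  obtain ⟨a, b, hab⟩ := exists_affine_le hf
  exact integrable_toReal_of_eint_ne_top (aemeasurable_comp hf hT) (integrable_affine hT a b)
    (Filter.Eventually.of_forall fun y => hab (T y)) h

theorem eint_comp_eq (hf : f ∈ cvx d) (hT : MemLp T 2 ν)
    (h : eint ν (fun y => f (T y)) ≠ ⊤) :
    eint ν (fun y => f (T y)) = ((∫ y, (f (T y)).toReal ∂ν : ℝ) : EReal) := by
  obtain ⟨a, b, hab⟩ := exists_affine_le hf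
  exact eint_eq_integral_toReal (aemeasurable_comp hf hT) (integrable_affine hT a b)
    (Filter.Eventually.of_forall fun y => hab (T y)) h

theorem eint_comp_convex_combination (hf : f ∈ cvx d) {S : α → Space d} (hS : MemLp S 2 ν)
    (hT : MemLp T 2 ν) (hfS : eint ν (fun y => f (S y)) ≠ ⊤) (hfT : eint ν (fun y => f (T y)) ≠ ⊤)
    {a b : ℝ} (ha : 0 ≤ a) (hb : 0 ≤ b) (hab : a + b = 1) :
    eint ν (fun y => f (a • S y + b • T y)) ≤
      ((a * ∫ y, (f (S y)).toReal ∂ν + b * ∫ y, (f (T y)).toReal ∂ν : ℝ) : EReal) := by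
  have hiS := (integrable_toReal_comp hf hS hfS).const_mul a
  have hiT := (integrable_toReal_comp hf hT hfT).const_mul b
  rw [← integral_const_mul, ← integral_const_mul, ← integral_add hiS hiT,
    ← eint_coe (g := fun y => a * (f (S y)).toReal + b * (f (T y)).toReal) (hiS.add hiT)]
  refine eint_mono_ae ?_
  filter_upwards [ae_comp_ne_top hf hS hfS, ae_comp_ne_top hf hT hfT] with y h1 h2
  exact le_convex_combination hf h1 h2 ha hb hab

/-- Lower semicontinuity of `T ↦ ∫ f(T) dν` on `L²(ν)`, in the form of closed sublevel sets. -/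
theorem isClosed_setOf_eint_comp_le (hf : f ∈ cvx d) {ℓ : Lp (Space d) 2 ν → ℝ}
    (hℓ : Continuous ℓ) :
    IsClosed {T : Lp (Space d) 2 ν | eint ν (fun y => f (T y)) ≤ (ℓ T : EReal)} := by
  obtain ⟨a, b, hab⟩ := exists_affine_le hf
  set h : Space d → ℝ≥0∞ := fun x => (f x - ((inner ℝ x a + b : ℝ) : EReal)).toENNReal
  have hh : LowerSemicontinuous h := by
    refine EReal.continuous_toENNReal.comp_lowerSemicontinuous ?_
      fun _ _ hxy => EReal.toENNReal_le_toENNReal hxy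
    simp only [sub_eq_add_neg, ← EReal.coe_neg]
    exact hf.1.add' (Continuous.lowerSemicontinuous
      (continuous_coe_real_ereal.comp (by fun_prop))) fun x =>
        EReal.continuousAt_add (Or.inr (EReal.coe_ne_bot _)) (Or.inr (EReal.coe_ne_top _))
  set m : Lp (Space d) 2 ν → ℝ := fun T => ∫ y, (inner ℝ (T y) a + b : ℝ) ∂ν
  have hm : Continuous m := by
    have : m = fun T => inner ℝ T (memLp_const a : MemLp (fun _ => a) 2 ν).toLp
        + ∫ _, b ∂ν := by
      ext T
      rw [inner_toLp, ← integral_add (integrable_inner (Lp.memLp T) (memLp_const a))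
        (integrable_const b)]
    rw [this]
    fun_prop
  -- The sign condition is kept apart because `ENNReal.ofReal` sends negative numbers to zero.
  have hiff : ∀ T : Lp (Space d) 2 ν, eint ν (fun y => f (T y)) ≤ (ℓ T : EReal) ↔
      0 ≤ ℓ T - m T ∧ ∫⁻ y, h (T y) ∂ν ≤ ENNReal.ofReal (ℓ T - m T) := by
    intro T
    rw [eint_eq_lintegral_add (aemeasurable_comp hf (Lp.memLp T))
      (integrable_affine (Lp.memLp T) a b) (Filter.Eventually.of_forall fun y => hab (T y))]
    change ((∫⁻ y, h (T y) ∂ν : ℝ≥0∞) : EReal) + (m T : EReal) ≤ _ ↔ _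
    rw [← EReal.le_sub_iff_add_le (Or.inl (EReal.coe_ne_bot _)) (Or.inl (EReal.coe_ne_top _)),
      ← EReal.coe_sub]
    constructor
    · intro hle
      have h0 : 0 ≤ ℓ T - m T := by
        have := (EReal.coe_ennreal_nonneg _).trans hle
        exact_mod_cast this
      refine ⟨h0, ?_⟩
      rw [← EReal.coe_ennreal_le_coe_ennreal_iff, EReal.coe_ennreal_ofReal, max_eq_left h0]
      exact hle
    · rintro ⟨h0, hle⟩
      rw [← EReal.coe_ennreal_le_coe_ennreal_iff, EReal.coe_ennreal_ofReal, max_eq_left h0] at hle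
      exact hle
  refine IsSeqClosed.isClosed fun T S hT hTS => ?_
  simp only [Set.mem_ofPred_eq, hiff] at hT ⊢
  have hlim : Filter.Tendsto (fun n => ℓ (T n) - m (T n)) Filter.atTop (nhds (ℓ S - m S)) :=
    ((hℓ.sub hm).tendsto S).comp hTS
  refine ⟨ge_of_tendsto' hlim fun n => (hT n).1, ?_⟩
  -- Along an a.e. convergent subsequence, Fatou's lemma applies to the nonnegative lower
  -- semicontinuous `h`.
  obtain ⟨ns, hns, hae⟩ := (tendstoInMeasure_of_tendsto_Lp hTS).exists_seq_tendsto_ae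
  have hlim' := (ENNReal.tendsto_ofReal hlim).comp hns.tendsto_atTop
  calc ∫⁻ y, h (S y) ∂ν
      ≤ ∫⁻ y, Filter.liminf (fun n => h (T (ns n) y)) Filter.atTop ∂ν := by
        refine lintegral_mono_ae ?_
        filter_upwards [hae] with y hy
        refine le_trans (LowerSemicontinuousAt.le_liminf (hh (S y))) ?_
        exact Filter.liminf_le_liminf_of_le (f := nhds (S y)) (u := h) hy
    _ ≤ Filter.liminf (fun n => ∫⁻ y, h (T (ns n) y) ∂ν) Filter.atTop :=
        lintegral_liminf_le fun n => hh.measurable.comp (Lp.stronglyMeasurable _).measurable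
    _ ≤ Filter.liminf (fun n => ENNReal.ofReal (ℓ (T (ns n)) - m (T (ns n)))) Filter.atTop :=
        Filter.liminf_le_liminf (Filter.Eventually.of_forall fun n => (hT (ns n)).2)
    _ = ENNReal.ofReal (ℓ S - m S) := hlim'.liminf_eq

theorem convex_setOf_eint_comp_le (hf : f ∈ cvx d) (ℓ : Lp (Space d) 2 ν → ℝ)
    (hℓ : ∀ S T (a b : ℝ), 0 ≤ a → 0 ≤ b → a + b = 1 → a * ℓ S + b * ℓ T ≤ ℓ (a • S + b • T)) :
    Convex ℝ {T : Lp (Space d) 2 ν | eint ν (fun y => f (T y)) ≤ (ℓ T : EReal)} := by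
  intro S hS T hT a b ha hb hab
  simp only [Set.mem_ofPred_eq] at hS hT ⊢
  have hS' := ne_top_of_le_ne_top (EReal.coe_ne_top _) hS
  have hT' := ne_top_of_le_ne_top (EReal.coe_ne_top _) hT
  have h := eint_comp_convex_combination hf (Lp.memLp S) (Lp.memLp T) hS' hT' ha hb hab
  rw [eint_comp_eq hf (Lp.memLp S) hS', EReal.coe_le_coe_iff] at hS
  rw [eint_comp_eq hf (Lp.memLp T) hT', EReal.coe_le_coe_iff] at hT
  refine (le_of_eq (eint_congr_ae ?_)).trans (h.trans (EReal.coe_le_coe_iff.2 ?_))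
  · filter_upwards [Lp.coeFn_add (a • S) (b • T), Lp.coeFn_smul a S, Lp.coeFn_smul b T]
      with y h1 h2 h3
    rw [h1, Pi.add_apply, h2, h3, Pi.smul_apply, Pi.smul_apply]
  · refine le_trans ?_ (hℓ S T a b ha hb hab)
    gcongr

end composition

/-! ### Finite combinations in the cone -/

section sums

variable {d : ℕ} {ι : Type*} {F : Set (EFun d)}

theorem sum_mem_cone (hF : IsFunctionCone F) (s : Finset ι) {f : ι → EFun d} (hf : ∀ i, f i ∈ F)
    {w : ι → ℝ} (hw : ∀ i, 0 ≤ w i) : (fun x => ∑ i ∈ s, (w i : EReal) * f i x) ∈ F := by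
  classical
  induction s using Finset.induction_on with
  | empty =>
    -- The empty sum is the zero function, which is `0 g + 0 g`.
    obtain ⟨g, hg⟩ := hF.1
    simpa using hF.2 g hg g hg 0 0 le_rfl le_rfl
  | insert i s hi ih =>
    have := hF.2 (f i) (hf i) _ ih (w i) 1 (hw i) zero_le_one
    simpa [Finset.sum_insert hi] using this

theorem sum_mul_eq_coe (s : Finset ι) {w : ι → ℝ} {e : ι → EReal} (ht : ∀ i, e i ≠ ⊤)
    (hb : ∀ i, e i ≠ ⊥) :
    ∑ i ∈ s, (w i : EReal) * e i = ((∑ i ∈ s, w i * (e i).toReal : ℝ) : EReal) := by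
  classical
  induction s using Finset.induction_on with
  | empty => simp
  | insert i s hi ih =>
    rw [Finset.sum_insert hi, Finset.sum_insert hi, ih, EReal.coe_add, EReal.coe_mul,
      EReal.coe_toReal (ht i) (hb i)]

theorem sum_mul_ne_bot (s : Finset ι) {w : ι → ℝ} (hw : ∀ i, 0 < w i) {e : ι → EReal}
    (hb : ∀ i, e i ≠ ⊥) : ∑ i ∈ s, (w i : EReal) * e i ≠ ⊥ := by
  classical
  induction s using Finset.induction_on with
  | empty => simp
  | insert i s hi ih =>
    rw [Finset.sum_insert hi]
    refine EReal.add_ne_bot_iff.2 ⟨?_, ih⟩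
    have := hb i
    generalize e i = c at *
    induction c with
    | bot => exact absurd rfl this
    | top => simp [EReal.coe_mul_top_of_pos (hw i)]
    | coe c => rw [← EReal.coe_mul]; exact EReal.coe_ne_bot _

/-- With a zero weight this fails, since `0 * ⊤ = 0`; hence the strictly positive weights in the
minimax argument. -/
theorem ne_top_of_sum_mul_ne_top [Fintype ι] {w : ι → ℝ} (hw : ∀ i, 0 < w i) {e : ι → EReal}
    (hb : ∀ i, e i ≠ ⊥) (h : ∑ i, (w i : EReal) * e i ≠ ⊤) (i : ι) : e i ≠ ⊤ := by
  classical
  intro hi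
  rw [← Finset.add_sum_erase _ _ (Finset.mem_univ i), hi, EReal.coe_mul_top_of_pos (hw i)] at h
  exact h (EReal.top_add_of_ne_bot (sum_mul_ne_bot _ hw hb))

theorem normSq_toReal (x : Space d) : (normSq d x).toReal = ‖x‖ ^ 2 := EReal.toReal_coe _

/-- A strictly positive combination of functions of the cone, one of them `‖·‖²`, has a conjugate
whose gradient is defined everywhere and Lipschitz. -/
theorem exists_lipschitz_argmin [Fintype ι] (hFc : F ⊆ cvx d) (hF : IsFunctionCone F)
    {f : ι → EFun d} (hf : ∀ i, f i ∈ F) {i₀ : ι} (hi₀ : f i₀ = normSq d) {w : ι → ℝ}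
    (hw : ∀ i, 0 < w i) :
    ∃ (T : Space d → Space d) (C : ℝ), (∀ y z, ‖T y - T z‖ ≤ C * ‖y - z‖) ∧ ∀ y,
      (∀ i, f i (T y) ≠ ⊤) ∧ ∀ x, (∀ i, f i x ≠ ⊤) →
        ∑ i, w i * (f i (T y)).toReal - inner ℝ (T y) y ≤
          ∑ i, w i * (f i x).toReal - inner ℝ x y := by
  classical
  -- Half of the weight of `‖·‖²` stays in `g`, which keeps every weight positive; the other half is
  -- the quadratic term of the proximal map.
  set w' : ι → ℝ := Function.update w i₀ (w i₀ / 2)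
  have hw' : ∀ i, 0 < w' i := fun i => by
    by_cases h : i = i₀
    · subst h; simpa [w'] using hw i
    · simpa [w', h] using hw i
  have hb : ∀ x i, f i x ≠ ⊥ := fun x i => (hFc (hf i)).2.2.1 x
  set g : EFun d := fun x => ∑ i, (w' i : EReal) * f i x
  have hg : g ∈ F := sum_mem_cone hF Finset.univ hf fun i => (hw' i).le
  obtain ⟨T, hT, hmin⟩ := exists_proximal_map (hFc hg) (δ := w i₀ / 2) (by have := hw i₀; positivity)
  have hval : ∀ x, (∀ i, f i x ≠ ⊤) → g x = ((∑ i, w' i * (f i x).toReal : ℝ) : EReal) :=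
    fun x hx => sum_mul_eq_coe _ hx (hb x)
  have hval' : ∀ x, (∀ i, f i x ≠ ⊤) →
      (g x).toReal + w i₀ / 2 * ‖x‖ ^ 2 = ∑ i, w i * (f i x).toReal := fun x hx => by
    rw [hval x hx, EReal.toReal_coe, ← Finset.add_sum_erase _ _ (Finset.mem_univ i₀),
      ← Finset.add_sum_erase _ (fun i => w i * _) (Finset.mem_univ i₀)]
    rw [Finset.sum_congr rfl (g := fun i => w i * (f i x).toReal) fun i hi => by
      simp [w', Finset.ne_of_mem_erase hi]]
    simp only [w', Function.update_self, hi₀, normSq_toReal]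
    ring
  refine ⟨T, _, hT, fun y => ?_⟩
  have hTy : ∀ i, f i (T y) ≠ ⊤ := ne_top_of_sum_mul_ne_top hw' (hb _) (hmin y).1
  refine ⟨hTy, fun x hx => ?_⟩
  rw [← hval' _ hTy, ← hval' _ hx]
  exact (hmin y).2 x (by rw [hval x hx]; exact EReal.coe_ne_top _)

end sums

/-! ### The Lagrangian and its maximisers -/

section dual

variable {d : ℕ} {F : Set (EFun d)} {μ ν : Measure (Space d)}

theorem memLp_of_lipschitz [IsFiniteMeasure ν] (hν : MemLp id 2 ν) {T : Space d → Space d} {C : ℝ}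
    (hT : ∀ y z, ‖T y - T z‖ ≤ C * ‖y - z‖) : Continuous T ∧ MemLp T 2 ν := by
  have hc : Continuous T := by
    refine (LipschitzWith.of_dist_le_mul (K := C.toNNReal) fun y z => ?_).continuous
    rw [dist_eq_norm, dist_eq_norm]
    exact (hT y z).trans (mul_le_mul_of_nonneg_right (Real.le_coe_toNNReal C) (norm_nonneg _))
  refine ⟨hc, ?_⟩
  have h1 : MemLp (fun y => T y - T 0) 2 ν := by
    refine hν.of_le_mul (c := C) (hc.sub continuous_const).aestronglyMeasurable ?_
    exact Filter.Eventually.of_forall fun y => by simpa using hT y 0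
  refine (h1.add (memLp_const (T 0))).ae_eq (Filter.Eventually.of_forall fun y => ?_)
  simp

/-- The Lagrangian of the duality problem. -/
noncomputable def lagrangian (μ ν : Measure (Space d)) (f : EFun d) (T : Space d → Space d) : ℝ :=
  ∫ y, (inner ℝ (T y) y : ℝ) ∂ν + ∫ x, (f x).toReal ∂μ - ∫ y, (f (T y)).toReal ∂ν

theorem lagrangian_congr {f : EFun d} {S T : Space d → Space d} (h : S =ᵐ[ν] T) :
    lagrangian μ ν f S = lagrangian μ ν f T := by
  unfold lagrangian
  have h1 : ∫ y, (inner ℝ (S y) y : ℝ) ∂ν = ∫ y, (inner ℝ (T y) y : ℝ) ∂ν :=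
    integral_congr_ae (h.mono fun y hy => by simp only [hy])
  have h2 : ∫ y, (f (S y)).toReal ∂ν = ∫ y, (f (T y)).toReal ∂ν :=
    integral_congr_ae (h.mono fun y hy => by simp only [hy])
  rw [h1, h2]

variable [IsProbabilityMeasure ν]

/-- As the weights sum to one, the correlation term appears once, and the dependence on `T` becomes
a single integral that can be maximised pointwise in `y`. -/
theorem sum_mul_lagrangian {ι : Type*} [Fintype ι] (hFc : F ⊆ cvx d) (hν : MemLp id 2 ν)
    {f : ι → EFun d} (hf : ∀ i, f i ∈ F) {w : ι → ℝ} (hw1 : ∑ i, w i = 1) {T : Space d → Space d}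
    (hT : MemLp T 2 ν) (hfT : ∀ i, eint ν (fun y => f i (T y)) ≠ ⊤) :
    Integrable (fun y => inner ℝ (T y) y - ∑ i, w i * (f i (T y)).toReal) ν ∧
    ∑ i, w i * lagrangian μ ν (f i) T = ∑ i, w i * ∫ x, (f i x).toReal ∂μ +
      ∫ y, (inner ℝ (T y) y - ∑ i, w i * (f i (T y)).toReal) ∂ν := by
  have h1 : Integrable (fun y => (inner ℝ (T y) y : ℝ)) ν := integrable_inner hT hν
  have h2 : ∀ i, Integrable (fun y => w i * (f i (T y)).toReal) ν := fun i =>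
    (integrable_toReal_comp (hFc (hf i)) hT (hfT i)).const_mul _
  have h3 : Integrable (fun y => ∑ i, w i * (f i (T y)).toReal) ν :=
    integrable_finsetSum _ fun i _ => h2 i
  refine ⟨h1.sub h3, ?_⟩
  rw [integral_sub h1 h3, integral_finsetSum _ fun i _ => h2 i]
  simp only [integral_const_mul, lagrangian, mul_sub, mul_add, Finset.sum_sub_distrib,
    Finset.sum_add_distrib, ← Finset.sum_mul, hw1]
  ring

/-- For strictly positive weights, the supremum of the weighted Lagrangian is attained, and it is
at least the value of the primal problem. -/
theorem exists_argmax_sum_lagrangian [IsFiniteMeasure μ] {ι : Type*} [Fintype ι] (hFc : F ⊆ cvx d)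
    (hF : IsFunctionCone F) (hμ : MemLp id 2 μ) (hν : MemLp id 2 ν) {V : ℝ}
    (hV : ∀ f ∈ F, (V : EReal) ≤ eintegral μ f + eintegral ν (conjugate f))
    {f : ι → EFun d} (hf : ∀ i, f i ∈ F) (hfμ : ∀ i, eintegral μ (f i) ≠ ⊤)
    {i₀ : ι} (hi₀ : f i₀ = normSq d) {w : ι → ℝ} (hw : ∀ i, 0 < w i) (hw1 : ∑ i, w i = 1) :
    ∃ T : Space d → Space d, MemLp T 2 ν ∧ (∀ i, eint ν (fun y => f i (T y)) ≠ ⊤) ∧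
      V ≤ ∑ i, w i * lagrangian μ ν (f i) T ∧
      ∀ S : Space d → Space d, MemLp S 2 ν → (∀ i, eint ν (fun y => f i (S y)) ≠ ⊤) →
        ∑ i, w i * lagrangian μ ν (f i) S ≤ ∑ i, w i * lagrangian μ ν (f i) T := by
  classical
  have hb : ∀ x i, f i x ≠ ⊥ := fun x i => (hFc (hf i)).2.2.1 x
  obtain ⟨T, C, hTC, hT⟩ := exists_lipschitz_argmin hFc hF hf hi₀ hw
  obtain ⟨hTc, hTm⟩ := memLp_of_lipschitz hν hTC
  choose a b hab using fun i => exists_affine_le (hFc (hf i))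
  have hgi : ∀ i, Integrable (fun y => (inner ℝ (T y) (a i) + b i : ℝ)) ν := fun i =>
    integrable_affine hTm (a i) (b i)
  have hTi : Integrable (fun y => (inner ℝ (T y) y : ℝ)) ν := integrable_inner hTm hν
  have hfT : ∀ i, eint ν (fun y => f i (T y)) ≠ ⊤ := by
    intro i
    -- `U` is an integrable majorant of `f i (T y)`. Optimality against the competitor `T 0` bounds
    -- the weighted sum at `T y`, and the affine minorants of all the `f j` isolate one term of it.
    set c := ∑ j, w j * (f j (T 0)).toReal
    set U : Space d → ℝ := fun y => (w i)⁻¹ * (c - inner ℝ (T 0) y + inner ℝ (T y) y -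
      ∑ j, w j * (inner ℝ (T y) (a j) + b j)) + (inner ℝ (T y) (a i) + b i)
    have hU : Integrable U ν := by
      refine Integrable.add (Integrable.const_mul (Integrable.sub (Integrable.add ?_ hTi)
        (integrable_finsetSum _ fun j _ => (hgi j).const_mul _)) _) (hgi i)
      exact (integrable_const c).sub (integrable_inner (memLp_const (T 0)) hν)
    refine ne_top_of_le_ne_top (EReal.coe_ne_top (∫ y, U y ∂ν)) ?_
    rw [← eint_coe hU]
    refine eint_mono_ae (Filter.Eventually.of_forall fun y => ?_)
    have h1 := (hT y).2 (T 0) (hT 0).1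
    have h2 : ∀ j, 0 ≤ w j * ((f j (T y)).toReal - (inner ℝ (T y) (a j) + b j)) := fun j => by
      refine mul_nonneg (hw j).le (sub_nonneg.2 ?_)
      rw [← EReal.coe_le_coe_iff, EReal.coe_toReal ((hT y).1 j) (hb _ j)]
      exact hab j (T y)
    have h3 := Finset.single_le_sum (f := fun j => w j * ((f j (T y)).toReal -
      (inner ℝ (T y) (a j) + b j))) (fun j _ => h2 j) (Finset.mem_univ i)
    simp only [mul_sub (w _), Finset.sum_sub_distrib] at h3
    rw [← EReal.coe_toReal ((hT y).1 i) (hb _ i), EReal.coe_le_coe_iff]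
    simp only [U]
    rw [← sub_le_iff_le_add, le_inv_mul_iff₀ (hw i)]
    linarith
  obtain ⟨hint, heq⟩ := sum_mul_lagrangian (μ := μ) hFc hν hf hw1 hTm hfT
  refine ⟨T, hTm, hfT, ?_, fun S hS hfS => ?_⟩
  · rw [heq]
    set g : EFun d := fun x => ∑ i, (w i : EReal) * f i x
    have h1 : eintegral μ g ≤ ((∑ i, w i * ∫ x, (f i x).toReal ∂μ : ℝ) : EReal) := by
      have hi : ∀ i, Integrable (fun x => w i * (f i x).toReal) μ := fun i =>
        (integrable_toReal_comp (T := id) (hFc (hf i)) hμ (hfμ i)).const_mul _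
      simp only [← integral_const_mul]
      rw [← integral_finsetSum _ fun i _ => hi i,
        ← eint_coe (integrable_finsetSum _ fun i _ => hi i), eintegral_eq_eint]
      refine eint_mono_ae ?_
      filter_upwards [ae_all_iff.2 fun i => ae_comp_ne_top (T := id) (hFc (hf i)) hμ (hfμ i)]
        with x hx
      exact (sum_mul_eq_coe _ hx (hb x)).le
    -- `T y` attains the supremum defining `g⋆(y)`, so the integrand on the right dominates `g⋆`.
    have h2 : eintegral ν (conjugate g) ≤
        ((∫ y, (inner ℝ (T y) y - ∑ i, w i * (f i (T y)).toReal) ∂ν : ℝ) : EReal) := by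
      rw [← eint_coe hint, eintegral_eq_eint]
      refine eint_mono_ae (Filter.Eventually.of_forall fun y => iSup_le fun x => ?_)
      by_cases hx : g x = ⊤
      · rw [hx, EReal.sub_top]; exact bot_le
      · have hx' := ne_top_of_sum_mul_ne_top hw (hb x) hx
        have := (hT y).2 x hx'
        have e : g x = _ := sum_mul_eq_coe Finset.univ (w := w) hx' (hb x)
        rw [e, ← EReal.coe_sub, EReal.coe_le_coe_iff]
        linarith
    have h3 := (hV g (sum_mem_cone hF _ hf fun i => (hw i).le)).trans (add_le_add h1 h2)
    exact_mod_cast h3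
  · obtain ⟨hint', heq'⟩ := sum_mul_lagrangian (μ := μ) hFc hν hf hw1 hS hfS
    rw [heq, heq']
    gcongr 1
    refine integral_mono_ae hint' hint ?_
    filter_upwards [ae_all_iff.2 fun i => ae_comp_ne_top (hFc (hf i)) hS (hfS i)] with y hy
    have := (hT y).2 (S y) hy
    change _ - _ ≤ _ - _
    linarith

/-- The correlation is linear in `T` and `∫ f(T) dν` is convex. The domain asks for finiteness for
the whole family, so that all Lagrangians share it. -/
theorem concaveOn_lagrangian {ι : Type*} (hFc : F ⊆ cvx d) (hν : MemLp id 2 ν)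
    {f : ι → EFun d} (hf : ∀ i, f i ∈ F) (i : ι) :
    ConcaveOn ℝ {T : Lp (Space d) 2 ν | ∀ i, eint ν (fun y => f i (T y)) ≠ ⊤}
      fun T => lagrangian μ ν (f i) T := by
  have hae : ∀ (S T : Lp (Space d) 2 ν) (a b : ℝ),
      (a • S + b • T : Lp (Space d) 2 ν) =ᵐ[ν] fun y => a • S y + b • T y := fun S T a b => by
    filter_upwards [Lp.coeFn_add (a • S) (b • T), Lp.coeFn_smul a S, Lp.coeFn_smul b T]
      with y h1 h2 h3
    rw [h1, Pi.add_apply, h2, h3, Pi.smul_apply, Pi.smul_apply]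
  have hkey : ∀ (S T : Lp (Space d) 2 ν) (a b : ℝ) (j : ι), eint ν (fun y => f j (S y)) ≠ ⊤ →
      eint ν (fun y => f j (T y)) ≠ ⊤ → 0 ≤ a → 0 ≤ b → a + b = 1 →
      eint ν (fun y => f j ((a • S + b • T : Lp (Space d) 2 ν) y)) ≤
        ((a * ∫ y, (f j (S y)).toReal ∂ν + b * ∫ y, (f j (T y)).toReal ∂ν : ℝ) : EReal) := by
    intro S T a b j hS hT ha hb hab
    refine (le_of_eq (eint_congr_ae ?_)).trans
      (eint_comp_convex_combination (hFc (hf j)) (Lp.memLp S) (Lp.memLp T) hS hT ha hb hab)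
    exact (hae S T a b).mono fun y hy => by rw [hy]
  refine ⟨fun S hS T hT a b ha hb hab j => ?_, fun S hS T hT a b ha hb hab => ?_⟩
  · exact ne_top_of_le_ne_top (EReal.coe_ne_top _) (hkey S T a b j (hS j) (hT j) ha hb hab)
  · have h := hkey S T a b i (hS i) (hT i) ha hb hab
    rw [eint_comp_eq (hFc (hf i)) (Lp.memLp _)
      (ne_top_of_le_ne_top (EReal.coe_ne_top _) h), EReal.coe_le_coe_iff] at h
    have e : ∀ R : Lp (Space d) 2 ν, ∫ y, (inner ℝ (R y) y : ℝ) ∂ν = inner ℝ R hν.toLp :=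
      fun R => (inner_toLp R hν).symm
    simp only [lagrangian, e, smul_eq_mul]
    rw [inner_add_left, inner_smul_left, inner_smul_left]
    simp only [conj_trivial]
    have : b = 1 - a := by linarith
    subst this
    linarith

end dual

/-! ### Attainment in the dual problem -/

section optimal

variable {d : ℕ} {F : Set (EFun d)} {μ ν : Measure (Space d)}

theorem eintegral_normSq [IsFiniteMeasure μ] (hμ : MemLp id 2 μ) :
    eintegral μ (normSq d) = ((∫ x, ‖x‖ ^ 2 ∂μ : ℝ) : EReal) :=
  eint_coe (by simpa using hμ.integrable_norm_pow (p := 2) two_ne_zero)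

/-- The dual problem is attained by a map: there is `T` with `T#ν ⪯_F μ` whose correlation with the
identity is at least the value of the primal problem. -/
theorem exists_optimal_map [IsProbabilityMeasure μ] [IsProbabilityMeasure ν] (hFc : F ⊆ cvx d)
    (hF : IsFunctionCone F) (hnorm : normSq d ∈ F) (hμ : MemLp id 2 μ) (hν : MemLp id 2 ν) {V : ℝ}
    (hV : ∀ f ∈ F, (V : EReal) ≤ eintegral μ f + eintegral ν (conjugate f)) :
    ∃ T : Space d → Space d, Measurable T ∧ MemLp T 2 ν ∧ V ≤ ∫ y, (inner ℝ (T y) y : ℝ) ∂ν ∧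
      ∀ f ∈ F, eint ν (fun y => f (T y)) ≤ eintegral μ f := by
  classical
  -- Functions with infinite `μ`-integral impose no constraint on `T`.
  let F' : Set (EFun d) := {f | f ∈ F ∧ eintegral μ f ≠ ⊤}
  have hn' : normSq d ∈ F' := ⟨hnorm, by rw [eintegral_normSq hμ]; exact EReal.coe_ne_top _⟩
  set I : EFun d → ℝ := fun f => ∫ x, (f x).toReal ∂μ
  have hI : ∀ f ∈ F', eintegral μ f = (I f : EReal) := fun f hf =>
    eint_comp_eq (T := id) (hFc hf.1) hμ hf.2
  set Y : Lp (Space d) 2 ν := hν.toLp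
  have hY : ∀ R : Lp (Space d) 2 ν, ∫ y, (inner ℝ (R y) y : ℝ) ∂ν = inner ℝ R Y :=
    fun R => (inner_toLp R hν).symm
  -- These `T` have Lagrangian at least `V - 1 / (n + 1)`. The slack is needed because the minimax
  -- lemma only reaches levels strictly below `V`.
  set K : F' × ℕ → Set (Lp (Space d) 2 ν) := fun i =>
    {T | eint ν (fun y => i.1.1 (T y)) ≤
      ((inner ℝ T Y + (I i.1.1 - (V - 1 / ((i.2 : ℝ) + 1))) : ℝ) : EReal)}
  set B := |I (normSq d) - (V - 1)| + 1
  obtain ⟨T, hT⟩ := nonempty_iInter_of_closed_convex_bounded K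
    (fun i => isClosed_setOf_eint_comp_le (hFc i.1.2.1) (by fun_prop))
    (fun i => convex_setOf_eint_comp_le (hFc i.1.2.1) _ fun S T a b ha hb hab => by
      rw [inner_add_left, inner_smul_left, inner_smul_left]
      simp only [conj_trivial]
      have : b = 1 - a := by linarith
      subst this
      linarith) (‖Y‖ + B) fun u => by
      -- Adding `‖·‖²` gives strong convexity, and also `‖T‖² ≤ ⟨T, Y⟩ + B`, which keeps `T` in the
      -- ball of radius `‖Y‖ + B`.
      set s : Finset F' := insert ⟨normSq d, hn'⟩ (u.image Prod.fst)
      set N := u.sup Prod.snd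
      set f : s → EFun d := fun i => i.1.1
      have : Nonempty s := ⟨⟨⟨normSq d, hn'⟩, Finset.mem_insert_self _ _⟩⟩
      obtain ⟨T, hTD, hTL⟩ := exists_forall_le_of_forall_weights
        (D := {T : Lp (Space d) 2 ν | ∀ i, eint ν (fun y => f i (T y)) ≠ ⊤})
        (L := fun i T => lagrangian μ ν (f i) T) (V := V) (c := V - 1 / ((N : ℝ) + 1))
        (concaveOn_lagrangian hFc hν fun i => i.1.2.1)
        (fun w hw hw1 => by
          obtain ⟨T, hTm, hT, hTV, hmax⟩ := exists_argmax_sum_lagrangian hFc hF hμ hν hV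
            (f := f) (fun i => i.1.2.1) (fun i => i.1.2.2)
            (i₀ := ⟨⟨normSq d, hn'⟩, Finset.mem_insert_self _ _⟩) rfl hw hw1
          have hco : ∀ i, lagrangian μ ν (f i) hTm.toLp = lagrangian μ ν (f i) T := fun i =>
            lagrangian_congr hTm.coeFn_toLp
          refine ⟨hTm.toLp, fun i => ?_, ?_, fun S hS => ?_⟩
          · rw [eint_congr_ae (g := fun y => f i (T y))
              (hTm.coeFn_toLp.mono fun y hy => by simp only [hy])]
            exact hT i
          · simpa only [hco] using hTV
          · simpa only [hco] using hmax S (Lp.memLp S) hS) (sub_lt_self _ (by positivity))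
      have hval : ∀ g (hg : g ∈ F') (hgs : (⟨g, hg⟩ : F') ∈ s),
          eint ν (fun y => g (T y)) = ((∫ y, (g (T y)).toReal ∂ν : ℝ) : EReal) ∧
          ∫ y, (g (T y)).toReal ∂ν ≤ inner ℝ T Y + (I g - (V - 1 / ((N : ℝ) + 1))) := by
        intro g hg hgs
        refine ⟨eint_comp_eq (hFc hg.1) (Lp.memLp T) (hTD ⟨⟨g, hg⟩, hgs⟩), ?_⟩
        have h1 := hTL ⟨⟨g, hg⟩, hgs⟩
        simp only [lagrangian, hY, f] at h1
        change _ ≤ _ + I g - _ at h1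
        linarith
      refine ⟨T, ?_, fun i hi => ?_⟩
      · have h1 := (hval _ hn' (Finset.mem_insert_self _ _)).2
        have h2 : ∫ y, (normSq d (T y)).toReal ∂ν = ‖T‖ ^ 2 := by
          simp only [normSq_toReal]
          rw [← real_inner_self_eq_norm_sq, L2.inner_def]
          simp only [real_inner_self_eq_norm_sq]
        rw [h2] at h1
        have h3 := real_inner_le_norm T Y
        have h4 : 1 / ((N : ℝ) + 1) ≤ 1 := by
          rw [div_le_one (by positivity)]; simp
        have h5 := le_abs_self (I (normSq d) - (V - 1))
        have hB : 1 ≤ B := by simp [B]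
        by_contra hcon
        push Not at hcon
        have h6 : I (normSq d) - (V - 1) ≤ B := h5.trans (by simp [B])
        have h7 : ‖T‖ * (‖Y‖ + B) < ‖T‖ * ‖T‖ := by
          refine mul_lt_mul_of_pos_left hcon ?_
          have := norm_nonneg Y
          linarith
        have h8 : 1 ≤ ‖T‖ := by have := norm_nonneg Y; linarith
        nlinarith
      · obtain ⟨h1, h2⟩ := hval i.1.1 i.1.2
          (Finset.mem_insert_of_mem (Finset.mem_image_of_mem _ hi))
        change eint ν (fun y => i.1.1 (T y)) ≤ _
        rw [h1, EReal.coe_le_coe_iff]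
        refine h2.trans ?_
        have h3 : (i.2 : ℝ) ≤ N := by exact_mod_cast Finset.le_sup (f := Prod.snd) hi
        have h4 : 1 / ((N : ℝ) + 1) ≤ 1 / ((i.2 : ℝ) + 1) :=
          one_div_le_one_div_of_le (by positivity) (by linarith)
        linarith
  have hfin : ∀ f ∈ F', eint ν (fun y => f (T y)) = ((∫ y, (f (T y)).toReal ∂ν : ℝ) : EReal) :=
    fun f hf => eint_comp_eq (hFc hf.1) (Lp.memLp T)
      (ne_top_of_le_ne_top (EReal.coe_ne_top _) (hT (⟨f, hf⟩, 0)))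
  have hle : ∀ f ∈ F', ∫ y, (f (T y)).toReal ∂ν ≤ inner ℝ T Y + (I f - V) := by
    intro f hf
    refine le_of_forall_pos_le_add fun ε hε => ?_
    obtain ⟨n, hn⟩ := exists_nat_one_div_lt hε
    have h1 : eint ν (fun y => f (T y)) ≤ _ := hT (⟨f, hf⟩, n)
    rw [hfin f hf, EReal.coe_le_coe_iff] at h1
    simp only at h1
    linarith
  -- Since `t f` is again in the cone, the inequality `hle` holds at every scale.
  have hscale : ∀ f ∈ F', ∀ t : ℝ, 0 ≤ t →
      t * ∫ y, (f (T y)).toReal ∂ν ≤ inner ℝ T Y + (t * I f - V) := by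
    intro f hf t ht
    have hmul : ∀ x, f x ≠ ⊤ → (t : EReal) * f x + ((0 : ℝ) : EReal) * f x =
        ((t * (f x).toReal : ℝ) : EReal) := fun x hx => by
      rw [← coe_toReal_of_mem_cvx (hFc hf.1) hx]
      norm_cast
      simp
    set g : EFun d := fun x => (t : EReal) * f x + ((0 : ℝ) : EReal) * f x
    have hgF : g ∈ F := hF.2 f hf.1 f hf.1 t 0 ht le_rfl
    have hiμ : Integrable (fun x => t * (f x).toReal) μ :=
      (integrable_toReal_comp (T := id) (hFc hf.1) hμ hf.2).const_mul t
    have hgμ : eintegral μ g = ((t * I f : ℝ) : EReal) := by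
      rw [eintegral_eq_eint, ← integral_const_mul, ← eint_coe hiμ]
      refine eint_congr_ae ?_
      filter_upwards [ae_comp_ne_top (T := id) (hFc hf.1) hμ hf.2] with x hx using hmul x hx
    have hg' : g ∈ F' := ⟨hgF, by rw [hgμ]; exact EReal.coe_ne_top _⟩
    have h1 := hle g hg'
    have h2 : I g = t * I f := by
      have := hI g hg'
      rw [hgμ] at this
      exact_mod_cast this.symm
    have h3 : ∫ y, (g (T y)).toReal ∂ν = t * ∫ y, (f (T y)).toReal ∂ν := by
      rw [← integral_const_mul]
      refine integral_congr_ae ?_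
      filter_upwards [ae_comp_ne_top (hFc hf.1) (Lp.memLp T)
        (by rw [hfin f hf]; exact EReal.coe_ne_top _)] with y hy
      simp only [g]
      rw [hmul _ hy, EReal.toReal_coe]
    rwa [h2, h3] at h1
  refine ⟨T, (Lp.stronglyMeasurable T).measurable, Lp.memLp T, ?_, fun f hf => ?_⟩
  · have := hscale _ hn' 0 le_rfl
    rw [hY]
    linarith
  · by_cases hft : eintegral μ f = ⊤
    · rw [hft]; exact le_top
    have hf' : f ∈ F' := ⟨hf, hft⟩
    rw [hI f hf', hfin f hf', EReal.coe_le_coe_iff]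
    by_contra hcon
    push Not at hcon
    set a := ∫ y, (f (T y)).toReal ∂ν
    -- At this scale a violated moment inequality would exceed the fixed gap `⟨T, Y⟩ - V`.
    set t := (|inner ℝ T Y - V| + 1) / (a - I f)
    have hpos : 0 < a - I f := by linarith
    have h1 := hscale f hf' t (by positivity)
    have h2 : t * (a - I f) = |inner ℝ T Y - V| + 1 := by
      simp only [t]; field_simp
    have h3 := le_abs_self (inner ℝ T Y - V)
    linarith

end optimal

/-! ### Quadratic cost, Fenchel-Young and Fenchel's equality -/

section cost

variable {d : ℕ} {α : Type*} [MeasurableSpace α] {ρ : Measure α} {u v : α → Space d}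

theorem integrable_half_normSq (hu : MemLp u 2 ρ) : Integrable (fun a => 1 / 2 * ‖u a‖ ^ 2) ρ := by
  simpa using (hu.integrable_norm_pow (p := 2) two_ne_zero).const_mul (1 / 2)

theorem integral_half_normSq_sub (hu : MemLp u 2 ρ) (hv : MemLp v 2 ρ) :
    ∫ a, 1 / 2 * ‖u a - v a‖ ^ 2 ∂ρ = ∫ a, 1 / 2 * ‖u a‖ ^ 2 ∂ρ + ∫ a, 1 / 2 * ‖v a‖ ^ 2 ∂ρ
      - ∫ a, (inner ℝ (u a) (v a) : ℝ) ∂ρ := by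
  rw [← integral_add (integrable_half_normSq hu) (integrable_half_normSq hv)]
  refine Eq.trans (integral_congr_ae (Filter.Eventually.of_forall fun a => ?_)) (integral_sub
    ((integrable_half_normSq hu).add (integrable_half_normSq hv)) (integrable_inner hu hv))
  simp only [norm_sub_sq_real]
  ring

theorem lintegral_half_normSq (hu : MemLp u 2 ρ) :
    ∫⁻ a, ENNReal.ofReal (1 / 2 * ‖u a‖ ^ 2) ∂ρ =
      ENNReal.ofReal (∫ a, 1 / 2 * ‖u a‖ ^ 2 ∂ρ) :=
  (ofReal_integral_eq_lintegral_ofReal (integrable_half_normSq hu)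
    (Filter.Eventually.of_forall fun a => by positivity)).symm

theorem lintegral_half_normSq_sub (hu : MemLp u 2 ρ) (hv : MemLp v 2 ρ) :
    ∫⁻ a, ENNReal.ofReal (1 / 2 * ‖u a - v a‖ ^ 2) ∂ρ =
      ENNReal.ofReal (∫ a, 1 / 2 * ‖u a‖ ^ 2 ∂ρ + ∫ a, 1 / 2 * ‖v a‖ ^ 2 ∂ρ
        - ∫ a, (inner ℝ (u a) (v a) : ℝ) ∂ρ) := by
  rw [← integral_half_normSq_sub hu hv]
  exact lintegral_half_normSq (hu.sub hv)

theorem memLp_two_of_lintegral_half_ne_top (hu : AEStronglyMeasurable u ρ)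
    (h : ∫⁻ a, ENNReal.ofReal (1 / 2 * ‖u a‖ ^ 2) ∂ρ ≠ ⊤) : MemLp u 2 ρ := by
  rw [memLp_two_iff_integrable_sq_norm hu]
  have h1 : Integrable (fun a => 1 / 2 * ‖u a‖ ^ 2) ρ := by
    refine ⟨by fun_prop, ?_⟩
    rw [hasFiniteIntegral_iff_ofReal (Filter.Eventually.of_forall fun a => by positivity)]
    exact h.lt_top
  refine (h1.const_mul 2).congr (Filter.Eventually.of_forall fun a => ?_)
  simp only
  ring

theorem W2sq_map_le (hu : Measurable u) (hv : Measurable v) :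
    W2sq (ρ.map u) (ρ.map v) ≤ ∫⁻ a, ENNReal.ofReal (1 / 2 * ‖u a - v a‖ ^ 2) ∂ρ := by
  have hmem : (ρ.map fun a => (u a, v a)) ∈ couplings (ρ.map u) (ρ.map v) :=
    ⟨Measure.map_map measurable_fst (hu.prodMk hv), Measure.map_map measurable_snd (hu.prodMk hv)⟩
  exact (iInf₂_le _ hmem).trans (lintegral_map (by fun_prop) (hu.prodMk hv)).le

theorem memLp_id_map (hu : Measurable u) : MemLp id 2 (ρ.map u) ↔ MemLp u 2 ρ :=
  memLp_map_measure_iff aestronglyMeasurable_id hu.aemeasurable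

theorem integral_half_normSq_map (hu : Measurable u) :
    ∫ x, 1 / 2 * ‖x‖ ^ 2 ∂(ρ.map u) = ∫ a, 1 / 2 * ‖u a‖ ^ 2 ∂ρ :=
  integral_map hu.aemeasurable (by fun_prop)

theorem halfMoment_eq {κ : Measure (Space d)} (hκ : MemLp id 2 κ) :
    halfMoment κ = ENNReal.ofReal (∫ x, 1 / 2 * ‖x‖ ^ 2 ∂κ) := lintegral_half_normSq hκ

theorem coe_halfMoment {κ : Measure (Space d)} (hκ : MemLp id 2 κ) :
    (halfMoment κ : EReal) = ((∫ x, 1 / 2 * ‖x‖ ^ 2 ∂κ : ℝ) : EReal) := by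
  rw [halfMoment_eq hκ, EReal.coe_ennreal_ofReal, max_eq_left]
  exact integral_nonneg fun x => by positivity

theorem eintegral_map {T : α → Space d} (hT : Measurable T) {g : EFun d} (hg : Measurable g) :
    eintegral (ρ.map T) g = eint ρ fun a => g (T a) := eint_map hT.aemeasurable hg

variable [IsFiniteMeasure ρ] {f : EFun d}

/-- Fenchel-Young holds pointwise. The affine minorants of `f` and `f⋆` keep both integrals away
from `⊥`, so an infinite one makes the sum `⊤`. -/
theorem integral_inner_le_eint_add (hf : f ∈ cvx d) (hu : MemLp u 2 ρ) (hv : MemLp v 2 ρ) :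
    ((∫ a, (inner ℝ (u a) (v a) : ℝ) ∂ρ : ℝ) : EReal) ≤
      eint ρ (fun a => f (u a)) + eint ρ (fun a => conjugate f (v a)) := by
  obtain ⟨a, b, hab⟩ := exists_affine_le_conjugate hf
  have hle : ∀ᵐ x ∂ρ, ((inner ℝ (v x) a + b : ℝ) : EReal) ≤ conjugate f (v x) :=
    Filter.Eventually.of_forall fun x => hab (v x)
  have hm : AEMeasurable (fun x => conjugate f (v x)) ρ :=
    (measurable_conjugate f).comp_aemeasurable hv.1.aemeasurable
  have hi := integrable_affine hv a b
  by_cases h1 : eint ρ (fun a => f (u a)) = ⊤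
  · rw [h1, EReal.top_add_of_ne_bot (eint_ne_bot hi hle)]
    exact le_top
  by_cases h2 : eint ρ (fun a => conjugate f (v a)) = ⊤
  · rw [h2, EReal.add_top_of_ne_bot (eint_comp_ne_bot hf hu)]
    exact le_top
  rw [eint_comp_eq hf hu h1, eint_eq_integral_toReal hm hi hle h2, ← EReal.coe_add,
    EReal.coe_le_coe_iff, ← integral_add (integrable_toReal_comp hf hu h1)
      (integrable_toReal_of_eint_ne_top hm hi hle h2)]
  refine integral_mono_ae (integrable_inner hu hv) ((integrable_toReal_comp hf hu h1).add
    (integrable_toReal_of_eint_ne_top hm hi hle h2)) ?_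
  filter_upwards [ae_comp_ne_top hf hu h1, ae_ne_top_of_eint_ne_top hm hi hle h2] with x h3 h4
  exact inner_le_add_conjugate h3 (hf.2.2.1 _) h4

/-- Fenchel's equality along a subgradient map, integrated. -/
theorem eintegral_add_conjugate_le_of_subdiff {μ : Measure (Space d)} [IsFiniteMeasure μ]
    (hμ : MemLp id 2 μ) (hf : f ∈ cvx d) {T : Space d → Space d} (hTm : Measurable T)
    (hT : MemLp T 2 μ) (hsub : ∀ᵐ x ∂μ, T x ∈ subdiff f x) :
    eintegral μ f + eintegral (μ.map T) (conjugate f) ≤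
      ((∫ x, (inner ℝ x (T x) : ℝ) ∂μ : ℝ) : EReal) := by
  have hfin : ∀ᵐ x ∂μ, f x ≠ ⊤ := by
    obtain ⟨x₀, hx₀⟩ := hf.2.2.2
    filter_upwards [hsub] with x hx htop
    have := hx x₀
    rw [htop, EReal.top_add_coe] at this
    exact hx₀ (top_le_iff.1 this)
  have hconj : ∀ᵐ x ∂μ, conjugate f (T x) ≤ ((inner ℝ x (T x) - (f x).toReal : ℝ) : EReal) := by
    filter_upwards [hsub, hfin] with x hx hx'
    refine iSup_le fun z => ?_
    by_cases hz : f z = ⊤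
    · rw [hz, EReal.sub_top]; exact bot_le
    have h := hx z
    rw [← coe_toReal_of_mem_cvx hf hz, ← coe_toReal_of_mem_cvx hf hx', ← EReal.coe_add,
      EReal.coe_le_coe_iff, inner_sub_right, real_inner_comm z, real_inner_comm x] at h
    rw [← coe_toReal_of_mem_cvx hf hz, ← EReal.coe_sub, EReal.coe_le_coe_iff]
    linarith
  have hin : Integrable (fun x => (inner ℝ x (T x) : ℝ)) μ := integrable_inner hμ hT
  -- An affine minorant of `f⋆` at `T x` turns `hconj` into an integrable upper bound for `f`.
  have hne : eint μ (fun x => f (id x)) ≠ ⊤ := by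
    obtain ⟨a, b, hab⟩ := exists_affine_le_conjugate hf
    have hi := hin.sub (integrable_affine hT a b)
    refine ne_top_of_le_ne_top (EReal.coe_ne_top _) ((eint_mono_ae ?_).trans (eint_coe hi).le)
    filter_upwards [hconj, hfin] with x h1 h2
    have h3 := (hab (T x)).trans h1
    rw [EReal.coe_le_coe_iff] at h3
    rw [id, ← coe_toReal_of_mem_cvx hf h2, EReal.coe_le_coe_iff]
    simp only [Pi.sub_apply]
    linarith
  have hif := integrable_toReal_comp (T := id) hf hμ hne
  have h1 : eintegral μ f = _ := eint_comp_eq (T := id) hf hμ hne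
  have h2 : eintegral (μ.map T) (conjugate f) ≤ _ :=
    (eintegral_map hTm (measurable_conjugate f)).le.trans
      ((eint_mono_ae hconj).trans (eint_coe (hin.sub hif)).le)
  rw [h1]
  refine (add_le_add_right h2 _).trans (le_of_eq ?_)
  rw [← EReal.coe_add]
  have h3 := integral_sub hin hif
  simp only [id] at h3 ⊢
  simp only [Pi.sub_apply, h3]
  congr 1
  ring

end cost

/-! ### Gluing and the triangle inequality -/

section gluing

open ProbabilityTheory

variable {d : ℕ}

/-- As an `L²` norm, the root of the cost obeys Minkowski's inequality. -/
theorem rpow_half_lintegral_half_normSq {α : Type*} [MeasurableSpace α] {ρ : Measure α}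
    (u : α → Space d) : (∫⁻ a, ENNReal.ofReal (1 / 2 * ‖u a‖ ^ 2) ∂ρ) ^ (1 / 2 : ℝ) =
      eLpNorm (fun a => √(1 / 2) • u a) 2 ρ := by
  rw [eLpNorm_eq_lintegral_rpow_enorm_toReal two_ne_zero ENNReal.ofNat_ne_top]
  simp only [ENNReal.toReal_ofNat]
  congr 1
  refine lintegral_congr fun a => ?_
  rw [← ofReal_norm, ENNReal.ofReal_rpow_of_nonneg (norm_nonneg _) (by norm_num),
    norm_smul, Real.norm_of_nonneg (Real.sqrt_nonneg _)]
  congr 1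
  rw [Real.rpow_two, mul_pow, Real.sq_sqrt (by norm_num)]

/-- The triangle inequality for `W₂`, through a push-forward. -/
theorem W2_le_add_W2_map {μ ν : Measure (Space d)} [IsProbabilityMeasure μ]
    {T : Space d → Space d} (hT : Measurable T) :
    W2 μ ν ≤ (∫⁻ x, ENNReal.ofReal (1 / 2 * ‖x - T x‖ ^ 2) ∂μ) ^ (1 / 2 : ℝ) + W2 (μ.map T) ν := by
  have key : ∀ π ∈ couplings (μ.map T) ν, W2 μ ν ≤
      (∫⁻ x, ENNReal.ofReal (1 / 2 * ‖x - T x‖ ^ 2) ∂μ) ^ (1 / 2 : ℝ) +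
        (∫⁻ p, ENNReal.ofReal (1 / 2 * ‖p.1 - p.2‖ ^ 2) ∂π) ^ (1 / 2 : ℝ) := by
    rintro π ⟨hπ1, hπ2⟩
    have : IsProbabilityMeasure (π.map Prod.fst) := by
      rw [hπ1]; exact Measure.isProbabilityMeasure_map hT.aemeasurable
    have : IsProbabilityMeasure π := Measure.isProbabilityMeasure_of_map Prod.fst
    -- Given `x`, the second point is drawn from `π` conditioned on its first coordinate being `T
    -- x`; under the resulting `γ` the pair `(T x, y)` has law `π`.
    set κ : Kernel (Space d) (Space d) := π.condKernel.comap T hT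
    set γ := μ.compProd κ
    have hγ1 : γ.map Prod.fst = μ := Measure.fst_compProd μ κ
    have hm : Measurable fun p : Space d × Space d => (T p.1, p.2) := by fun_prop
    have hγ2 : γ.map (fun p => (T p.1, p.2)) = π := by
      conv_rhs => rw [← π.disintegrate π.condKernel]
      have : π.fst = μ.map T := hπ1
      rw [this]
      have : IsProbabilityMeasure (μ.map T) := Measure.isProbabilityMeasure_map hT.aemeasurable
      ext s hs
      rw [Measure.map_apply hm hs, Measure.compProd_apply (hm hs), Measure.compProd_apply hs,
        lintegral_map (Kernel.measurable_kernel_prodMk_left hs) hT]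
      rfl
    have hγ3 : γ.map Prod.snd = ν := by
      rw [← hπ2, ← hγ2, Measure.map_map measurable_snd hm]
      rfl
    have h1 : W2sq μ ν ≤ ∫⁻ p, ENNReal.ofReal (1 / 2 * ‖p.1 - p.2‖ ^ 2) ∂γ :=
      iInf₂_le γ ⟨hγ1, hγ3⟩
    refine (ENNReal.rpow_le_rpow h1 (by norm_num)).trans ?_
    have e1 : ∫⁻ x, ENNReal.ofReal (1 / 2 * ‖x - T x‖ ^ 2) ∂μ =
        ∫⁻ p, ENNReal.ofReal (1 / 2 * ‖p.1 - T p.1‖ ^ 2) ∂γ := by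
      conv_lhs => rw [← hγ1]
      exact lintegral_map (by fun_prop) measurable_fst
    have e2 : ∫⁻ p, ENNReal.ofReal (1 / 2 * ‖p.1 - p.2‖ ^ 2) ∂π =
        ∫⁻ p, ENNReal.ofReal (1 / 2 * ‖T p.1 - p.2‖ ^ 2) ∂γ := by
      conv_lhs => rw [← hγ2]
      exact lintegral_map (by fun_prop) hm
    rw [e1, e2, rpow_half_lintegral_half_normSq, rpow_half_lintegral_half_normSq,
      rpow_half_lintegral_half_normSq]
    refine le_trans (le_of_eq ?_) (eLpNorm_add_le (by fun_prop) (by fun_prop) (by norm_num))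
    congr 1
    ext1 p
    simp only [Pi.add_apply, ← smul_add, sub_add_sub_cancel]
  -- The root is an order isomorphism of `[0, ∞]`, so it commutes with the infimum.
  have h2 : W2 (μ.map T) ν = ⨅ π ∈ couplings (μ.map T) ν,
      (∫⁻ p, ENNReal.ofReal (1 / 2 * ‖p.1 - p.2‖ ^ 2) ∂π) ^ (1 / 2 : ℝ) := by
    rw [W2, W2sq]
    simp only [← ENNReal.orderIsoRpow_apply (1 / 2 : ℝ) (by norm_num), OrderIso.map_iInf]
  rw [h2]
  simp only [ENNReal.add_iInf]
  exact le_iInf₂ key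

end gluing

/-! ### Duality, moment matching and embedding -/

section duality

variable {d : ℕ} {F : Set (EFun d)} {μ ν : Measure (Space d)}

/-- This self-conjugate function, with the identity as gradient, bounds the primal value from above
and puts `μ` itself in `∇F#μ`. -/
theorem half_smul_normSq_mem (hF : IsFunctionCone F) (hnorm : normSq d ∈ F) :
    (fun x => ((1 / 2 * ‖x‖ ^ 2 : ℝ) : EReal)) ∈ F := by
  have := hF.2 _ hnorm _ hnorm (1 / 2) 0 (by norm_num) le_rfl
  convert this using 2 with x
  simp only [normSq]
  norm_cast
  simp

/-- `V` is the value of the primal problem `inf_{f ∈ F} (∫ f dμ + ∫ f⋆ dν)`. -/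
def IsPrimalValue (F : Set (EFun d)) (μ ν : Measure (Space d)) (V : ℝ) : Prop :=
  ⨅ f ∈ F, (eintegral μ f + eintegral ν (conjugate f)) = (V : EReal)

theorem IsPrimalValue.le {V : ℝ} (hV : IsPrimalValue F μ ν V) {f : EFun d} (hf : f ∈ F) :
    (V : EReal) ≤ eintegral μ f + eintegral ν (conjugate f) := by
  rw [← hV]
  exact iInf₂_le f hf

/-- Weak duality for the joint law of `(u, v)`: Fenchel-Young, then the order `⪯_F` tested on `f`.
-/
theorem integral_inner_le_of_momentLE {α : Type*} [MeasurableSpace α] {ρ : Measure α}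
    [IsFiniteMeasure ρ] (hFc : F ⊆ cvx d) {u v : α → Space d} (hum : Measurable u)
    (hvm : Measurable v) (hu : MemLp u 2 ρ) (hv : MemLp v 2 ρ) (hle : MomentLE F (ρ.map u) μ)
    {f : EFun d} (hf : f ∈ F) :
    ((∫ a, (inner ℝ (u a) (v a) : ℝ) ∂ρ : ℝ) : EReal) ≤
      eintegral μ f + eintegral (ρ.map v) (conjugate f) := by
  refine (integral_inner_le_eint_add (hFc hf) hu hv).trans ?_
  rw [← eintegral_map hum (measurable_of_mem_cvx (hFc hf)),
    ← eintegral_map hvm (measurable_conjugate f)]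
  exact add_le_add_left (hle f hf) _

theorem IsPrimalValue.integral_inner_le {α : Type*} [MeasurableSpace α] {ρ : Measure α}
    [IsFiniteMeasure ρ] (hFc : F ⊆ cvx d) {V : ℝ} {u v : α → Space d} (hum : Measurable u)
    (hvm : Measurable v) (hu : MemLp u 2 ρ) (hv : MemLp v 2 ρ) (hle : MomentLE F (ρ.map u) μ)
    (hV : IsPrimalValue F μ (ρ.map v) V) : ∫ a, (inner ℝ (u a) (v a) : ℝ) ∂ρ ≤ V := by
  rw [← EReal.coe_le_coe_iff, ← hV]
  exact le_iInf₂ fun f hf => integral_inner_le_of_momentLE hFc hum hvm hu hv hle hf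

theorem memLp_of_mem_couplings {π : Measure (Space d × Space d)} {κ : Measure (Space d)}
    (hπ : π ∈ couplings κ ν) (hκ : MemLp id 2 κ) (hν : MemLp id 2 ν) :
    MemLp Prod.fst 2 π ∧ MemLp Prod.snd 2 π := by
  rw [← hπ.1] at hκ
  rw [← hπ.2] at hν
  exact ⟨(memLp_id_map measurable_fst).1 hκ, (memLp_id_map measurable_snd).1 hν⟩

theorem lintegral_coupling {π : Measure (Space d × Space d)} {κ : Measure (Space d)}
    (hπ : π ∈ couplings κ ν) (hκ : MemLp id 2 κ) (hν : MemLp id 2 ν) :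
    ∫⁻ p, ENNReal.ofReal (1 / 2 * ‖p.1 - p.2‖ ^ 2) ∂π =
      ENNReal.ofReal (∫ x, 1 / 2 * ‖x‖ ^ 2 ∂κ + ∫ x, 1 / 2 * ‖x‖ ^ 2 ∂ν -
        ∫ p, (inner ℝ p.1 p.2 : ℝ) ∂π) := by
  obtain ⟨h1, h2⟩ := memLp_of_mem_couplings hπ hκ hν
  rw [lintegral_half_normSq_sub h1 h2, ← integral_half_normSq_map measurable_fst,
    ← integral_half_normSq_map measurable_snd, hπ.1, hπ.2]

variable [IsProbabilityMeasure μ] [IsProbabilityMeasure ν]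

theorem prod_mem_couplings : μ.prod ν ∈ couplings μ ν := by
  constructor <;> simp

theorem W2sq_ne_top (hμ : MemLp id 2 μ) (hν : MemLp id 2 ν) : W2sq μ ν ≠ ⊤ := by
  have h : W2sq μ ν ≤ _ := iInf₂_le (μ.prod ν) prod_mem_couplings
  rw [lintegral_coupling prod_mem_couplings hμ hν] at h
  exact ne_top_of_le_ne_top ENNReal.ofReal_ne_top h

/-- Testing `½‖·‖²` bounds the infimum above; weak duality for the product coupling bounds it below,
so it is real. -/
theorem exists_isPrimalValue (hFc : F ⊆ cvx d) (hF : IsFunctionCone F) (hnorm : normSq d ∈ F)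
    (hμ : MemLp id 2 μ) (hν : MemLp id 2 ν) :
    ∃ V : ℝ, IsPrimalValue F μ ν V ∧
      V ≤ ∫ x, 1 / 2 * ‖x‖ ^ 2 ∂μ + ∫ x, 1 / 2 * ‖x‖ ^ 2 ∂ν := by
  set J := ⨅ f ∈ F, (eintegral μ f + eintegral ν (conjugate f))
  have h1 : J ≤ ((∫ x, 1 / 2 * ‖x‖ ^ 2 ∂μ + ∫ x, 1 / 2 * ‖x‖ ^ 2 ∂ν : ℝ) : EReal) := by
    refine (iInf₂_le _ (half_smul_normSq_mem hF hnorm)).trans ?_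
    rw [EReal.coe_add]
    refine add_le_add (eint_coe (integrable_half_normSq hμ)).le ?_
    refine le_trans (eint_mono_ae (Filter.Eventually.of_forall fun y => iSup_le fun x => ?_))
      (eint_coe (integrable_half_normSq hν)).le
    rw [← EReal.coe_sub, EReal.coe_le_coe_iff]
    have := norm_sub_sq_real x y
    have := sq_nonneg ‖x - y‖
    simp only [id]
    linarith
  have h2 : ((∫ p, (inner ℝ p.1 p.2 : ℝ) ∂(μ.prod ν) : ℝ) : EReal) ≤ J := by
    refine le_iInf₂ fun f hf => ?_
    obtain ⟨h3, h4⟩ := memLp_of_mem_couplings prod_mem_couplings hμ hν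
    have := integral_inner_le_of_momentLE (μ := μ) hFc measurable_fst measurable_snd h3 h4
      (by rw [prod_mem_couplings.1]; exact fun _ _ => le_rfl) hf
    rwa [prod_mem_couplings.2] at this
  have h3 : J ≠ ⊤ := ne_top_of_le_ne_top (EReal.coe_ne_top _) h1
  have h4 : J ≠ ⊥ := ne_bot_of_le_ne_bot (EReal.coe_ne_bot _) h2
  refine ⟨J.toReal, (EReal.coe_toReal h3 h4).symm, ?_⟩
  rwa [← EReal.coe_le_coe_iff, EReal.coe_toReal h3 h4]

omit [IsProbabilityMeasure μ] [IsProbabilityMeasure ν] in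
theorem IsPrimalValue.W2Fsq_eq {V : ℝ} (hV : IsPrimalValue F μ ν V) (hμ : MemLp id 2 μ)
    (hν : MemLp id 2 ν) :
    W2Fsq F μ ν = ((∫ x, 1 / 2 * ‖x‖ ^ 2 ∂μ + ∫ x, 1 / 2 * ‖x‖ ^ 2 ∂ν - V : ℝ) : EReal) := by
  rw [W2Fsq, coe_halfMoment hμ, coe_halfMoment hν, hV]
  norm_cast

omit [IsProbabilityMeasure μ] in
-- The cost of a coupling is the two half moments minus its correlation, and weak duality caps the
-- correlation by `V`.
theorem IsPrimalValue.ofReal_le_W2sq {V : ℝ} (hV : IsPrimalValue F μ ν V) (hFc : F ⊆ cvx d)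
    (hν : MemLp id 2 ν) {κ : Measure (Space d)} (hκ : MemLp id 2 κ) (hle : MomentLE F κ μ) :
    ENNReal.ofReal (∫ x, 1 / 2 * ‖x‖ ^ 2 ∂κ + ∫ x, 1 / 2 * ‖x‖ ^ 2 ∂ν - V) ≤ W2sq κ ν := by
  refine le_iInf₂ fun π hπ => ?_
  rw [lintegral_coupling hπ hκ hν]
  refine ENNReal.ofReal_le_ofReal ?_
  obtain ⟨h1, h2⟩ := memLp_of_mem_couplings hπ hκ hν
  have : IsProbabilityMeasure (π.map Prod.snd) := by rw [hπ.2]; infer_instance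
  have : IsProbabilityMeasure π := Measure.isProbabilityMeasure_of_map Prod.snd
  have := IsPrimalValue.integral_inner_le (μ := μ) (V := V) hFc measurable_fst measurable_snd h1 h2
    (by rw [hπ.1]; exact hle) (by rw [hπ.2]; exact hV)
  linarith

omit [IsProbabilityMeasure ν] in
/-- Measures below `μ` have finite second moment, which is at most that of `μ`. -/
theorem memLp_of_mem_lowerSet (hnorm : normSq d ∈ F) (hμ : MemLp id 2 μ)
    {κ : Measure (Space d)} (hκ : κ ∈ lowerSet F μ) :
    MemLp id 2 κ ∧ ∫ x, 1 / 2 * ‖x‖ ^ 2 ∂κ ≤ ∫ x, 1 / 2 * ‖x‖ ^ 2 ∂μ := by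
  have hfin := hκ.1
  have h := hκ.2 _ hnorm
  rw [eintegral_normSq hμ] at h
  have hL : MemLp id 2 κ := by
    rw [memLp_two_iff_integrable_sq_norm aestronglyMeasurable_id]
    refine ⟨by fun_prop, ?_⟩
    rw [hasFiniteIntegral_iff_ofReal (Filter.Eventually.of_forall fun a => by positivity)]
    have h0 : ∀ x : Space d, (-normSq d x).toENNReal = 0 := fun x => by
      rw [normSq, ← EReal.coe_neg, EReal.toENNReal_of_ne_top (EReal.coe_ne_top _),
        EReal.toReal_coe, ENNReal.ofReal_of_nonpos (by simp)]
    have h1 : ∀ x : Space d, (normSq d x).toENNReal = ENNReal.ofReal (‖id x‖ ^ 2) := fun x => by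
      rw [normSq, EReal.toENNReal_of_ne_top (EReal.coe_ne_top _), EReal.toReal_coe, id]
    rw [eintegral] at h
    simp only [h0, h1, lintegral_zero, EReal.coe_ennreal_zero, sub_zero] at h
    refine lt_top_iff_ne_top.2 fun htop => ?_
    rw [htop] at h
    exact EReal.coe_ne_top _ (top_le_iff.1 h)
  refine ⟨hL, ?_⟩
  rw [eintegral_normSq hL, EReal.coe_le_coe_iff] at h
  rw [integral_const_mul, integral_const_mul]
  linarith

/-- The dual problem is attained by a measure `T#ν`. -/
theorem IsPrimalValue.exists_optimal_map {V : ℝ} (hV : IsPrimalValue F μ ν V) (hFc : F ⊆ cvx d)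
    (hF : IsFunctionCone F) (hnorm : normSq d ∈ F) (hμ : MemLp id 2 μ) (hν : MemLp id 2 ν) :
    ∃ T : Space d → Space d, Measurable T ∧ MemLp T 2 ν ∧ ν.map T ∈ lowerSet F μ ∧
      V ≤ ∫ y, (inner ℝ (T y) y : ℝ) ∂ν := by
  obtain ⟨T, h1, h2, h3, h4⟩ := ConicOT.exists_optimal_map hFc hF hnorm hμ hν fun f hf => hV.le hf
  refine ⟨T, h1, h2, ⟨inferInstance, fun f hf => ?_⟩, h3⟩
  rw [eintegral_map h1 (measurable_of_mem_cvx (hFc hf))]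
  exact h4 f hf

/-- The previous cost bound handles every `κ`; for the optimal `T#ν`, the coupling `(T y, y)`
already achieves the value. -/
theorem W2Fsq_duality (hFc : F ⊆ cvx d) (hF : IsFunctionCone F) (hnorm : normSq d ∈ F)
    (hμ : MemLp id 2 μ) (hν : MemLp id 2 ν) :
    W2Fsq F μ ν = ⨅ κ ∈ lowerSet F μ,
      ((W2sq κ ν : EReal) + (halfMoment μ : EReal) - (halfMoment κ : EReal)) := by
  obtain ⟨V, hV, -⟩ := exists_isPrimalValue hFc hF hnorm hμ hν
  rw [hV.W2Fsq_eq hμ hν]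
  refine le_antisymm (le_iInf₂ fun κ hκ => ?_) ?_
  · obtain ⟨hκL, -⟩ := memLp_of_mem_lowerSet hnorm hμ hκ
    have h := EReal.coe_ennreal_le_coe_ennreal_iff.2 (hV.ofReal_le_W2sq hFc hν hκL hκ.2)
    rw [EReal.coe_ennreal_ofReal] at h
    rw [coe_halfMoment hμ, coe_halfMoment hκL]
    refine le_trans ?_ (EReal.sub_le_sub (add_le_add_left h _) le_rfl)
    norm_cast
    have := le_max_left (∫ x, 1 / 2 * ‖x‖ ^ 2 ∂κ + ∫ x, 1 / 2 * ‖x‖ ^ 2 ∂ν - V) 0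
    linarith
  · obtain ⟨T, hTm, hT, hlow, hVT⟩ := hV.exists_optimal_map hFc hF hnorm hμ hν
    refine (iInf₂_le _ hlow).trans ?_
    have hL := (memLp_id_map hTm).2 hT
    have hW := W2sq_map_le (ρ := ν) hTm measurable_id
    have hpos : 0 ≤ ∫ y, 1 / 2 * ‖T y - id y‖ ^ 2 ∂ν := integral_nonneg fun y => by positivity
    rw [Measure.map_id, lintegral_half_normSq (u := fun y => T y - id y) (hT.sub hν)] at hW
    have h := EReal.coe_ennreal_le_coe_ennreal_iff.2 hW
    rw [EReal.coe_ennreal_ofReal] at h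
    rw [max_eq_left hpos, integral_half_normSq_sub hT hν] at h
    rw [coe_halfMoment hμ, coe_halfMoment hL, integral_half_normSq_map hTm]
    refine (EReal.sub_le_sub (add_le_add_left h _) le_rfl).trans ?_
    norm_cast
    simp only [id] at hVT ⊢
    linarith

omit [IsProbabilityMeasure ν] in
theorem iInf_W2sq_le (hnorm : normSq d ∈ F) (hμ : MemLp id 2 μ) :
    (⨅ κ ∈ lowerSet F μ, (W2sq κ ν : EReal)) ≤ ⨅ κ ∈ lowerSet F μ,
      ((W2sq κ ν : EReal) + (halfMoment μ : EReal) - (halfMoment κ : EReal)) := by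
  refine iInf₂_mono fun κ hκ => ?_
  obtain ⟨hκL, hle⟩ := memLp_of_mem_lowerSet hnorm hμ hκ
  rw [coe_halfMoment hμ, coe_halfMoment hκL, add_sub_assoc, ← EReal.coe_sub]
  refine le_add_of_nonneg_right ?_
  exact_mod_cast sub_nonneg.2 hle

theorem W2Fsq_nonneg (hFc : F ⊆ cvx d) (hF : IsFunctionCone F) (hnorm : normSq d ∈ F)
    (hμ : MemLp id 2 μ) (hν : MemLp id 2 ν) : 0 ≤ W2Fsq F μ ν ∧ W2Fsq F μ ν ≠ ⊤ := by
  obtain ⟨V, hV, hle⟩ := exists_isPrimalValue hFc hF hnorm hμ hν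
  rw [hV.W2Fsq_eq hμ hν]
  exact ⟨by exact_mod_cast sub_nonneg.2 hle, EReal.coe_ne_top _⟩

omit [IsProbabilityMeasure μ] [IsProbabilityMeasure ν] in
theorem IsPrimalValue.toENNReal_W2Fsq {V : ℝ} (hV : IsPrimalValue F μ ν V) (hμ : MemLp id 2 μ)
    (hν : MemLp id 2 ν) : (W2Fsq F μ ν).toENNReal =
      ENNReal.ofReal (∫ x, 1 / 2 * ‖x‖ ^ 2 ∂μ + ∫ x, 1 / 2 * ‖x‖ ^ 2 ∂ν - V) := by
  rw [hV.W2Fsq_eq hμ hν, EReal.toENNReal_of_ne_top (EReal.coe_ne_top _), EReal.toReal_coe]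

omit [IsProbabilityMeasure μ] [IsProbabilityMeasure ν] in
theorem W2F_sq : W2F F μ ν ^ 2 = (W2Fsq F μ ν).toENNReal := by
  rw [W2F, ← ENNReal.rpow_natCast, ← ENNReal.rpow_mul]
  norm_num

omit [IsProbabilityMeasure μ] [IsProbabilityMeasure ν] in
theorem W2_sq : W2 μ ν ^ 2 = W2sq μ ν := by
  rw [W2, ← ENNReal.rpow_natCast, ← ENNReal.rpow_mul]
  norm_num

/-- A zero value leaves no room for `∫ ½‖T y - y‖² dν`, so `T#ν = ν` and the constraint on `T#ν` is
the claim. Conversely the diagonal coupling has correlation `∫ ‖y‖² dν`. -/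
theorem W2F_eq_zero_iff (hFc : F ⊆ cvx d) (hF : IsFunctionCone F) (hnorm : normSq d ∈ F)
    (hμ : MemLp id 2 μ) (hν : MemLp id 2 ν) :
    W2F F μ ν = 0 ↔ MomentLE F ν μ ∧ ∫ x, ‖x‖ ^ 2 ∂μ = ∫ x, ‖x‖ ^ 2 ∂ν := by
  obtain ⟨V, hV, -⟩ := exists_isPrimalValue hFc hF hnorm hμ hν
  have h0 : W2F F μ ν = 0 ↔ ∫ x, 1 / 2 * ‖x‖ ^ 2 ∂μ + ∫ x, 1 / 2 * ‖x‖ ^ 2 ∂ν - V ≤ 0 := by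
    rw [W2F, ENNReal.rpow_eq_zero_iff_of_pos (by norm_num), hV.toENNReal_W2Fsq hμ hν,
      ENNReal.ofReal_eq_zero]
  rw [h0]
  constructor
  · intro h
    obtain ⟨T, hTm, hT, hlow, hVT⟩ := hV.exists_optimal_map hFc hF hnorm hμ hν
    obtain ⟨-, hle⟩ := memLp_of_mem_lowerSet hnorm hμ hlow
    rw [integral_half_normSq_map hTm] at hle
    have e := integral_half_normSq_sub hT hν
    have hpos : 0 ≤ ∫ y, 1 / 2 * ‖T y - id y‖ ^ 2 ∂ν := integral_nonneg fun y => by positivity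
    simp only [id] at e hpos
    have hz : ∫ y, 1 / 2 * ‖T y - y‖ ^ 2 ∂ν = 0 := by linarith
    have hi : Integrable (fun y => 1 / 2 * ‖T y - y‖ ^ 2) ν :=
      integrable_half_normSq (u := fun y => T y - y) (hT.sub hν)
    rw [integral_eq_zero_iff_of_nonneg (fun y => by positivity) hi] at hz
    have hTid : ∀ᵐ y ∂ν, T y = y := by
      filter_upwards [hz] with y hy
      simpa [sub_eq_zero] using hy
    have hmap : ν.map T = ν := by
      rw [Measure.map_congr (g := id) hTid, Measure.map_id]
    rw [hmap] at hlow
    refine ⟨hlow.2, ?_⟩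
    have e2 : ∫ y, 1 / 2 * ‖T y‖ ^ 2 ∂ν = ∫ y, 1 / 2 * ‖y‖ ^ 2 ∂ν := by
      rw [← integral_half_normSq_map hTm, hmap]
    rw [e2] at e hle
    have h1 : ∫ x, 1 / 2 * ‖x‖ ^ 2 ∂μ = ∫ x, 1 / 2 * ‖x‖ ^ 2 ∂ν := by linarith
    rw [integral_const_mul, integral_const_mul] at h1
    linarith
  · rintro ⟨hle, heq⟩
    have h1 := IsPrimalValue.integral_inner_le (ρ := ν) (μ := μ) (V := V) hFc measurable_id
      measurable_id hν hν (by rwa [Measure.map_id]) (by rwa [Measure.map_id])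
    have h2 : ∫ y, (inner ℝ (id y) (id y) : ℝ) ∂ν = ∫ y, ‖y‖ ^ 2 ∂ν := by
      simp only [real_inner_self_eq_norm_sq, id]
    rw [integral_const_mul, integral_const_mul, heq]
    linarith

theorem W2F_le_W2 (hFc : F ⊆ cvx d) (hF : IsFunctionCone F) (hnorm : normSq d ∈ F)
    (hμ : MemLp id 2 μ) (hν : MemLp id 2 ν) : W2F F μ ν ≤ W2 μ ν := by
  obtain ⟨V, hV, -⟩ := exists_isPrimalValue hFc hF hnorm hμ hν
  rw [W2F, W2, hV.toENNReal_W2Fsq hμ hν]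
  exact ENNReal.rpow_le_rpow (hV.ofReal_le_W2sq hFc hν hμ fun _ _ => le_rfl) (by norm_num)

/-- Fenchel's equality gives `V ≤ ∫ ⟨x, T x⟩ dμ`, so the coupling `(x, T x)` costs at most
`W²_{2,F}`. -/
theorem W2F_eq_W2_of_mem_gradPush (hFc : F ⊆ cvx d) (hF : IsFunctionCone F)
    (hnorm : normSq d ∈ F) (hμ : MemLp id 2 μ) (hν : MemLp id 2 ν) (h : ν ∈ gradPush F μ) :
    W2F F μ ν = W2 μ ν := by
  refine le_antisymm (W2F_le_W2 hFc hF hnorm hμ hν) ?_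
  obtain ⟨V, hV, -⟩ := exists_isPrimalValue hFc hF hnorm hμ hν
  rw [W2F, W2, hV.toENNReal_W2Fsq hμ hν]
  refine ENNReal.rpow_le_rpow ?_ (by norm_num)
  obtain ⟨f, hf, T, hTm, hsub, rfl⟩ := h
  have hT := (memLp_id_map hTm).1 hν
  have h1 := (hV.le hf).trans (eintegral_add_conjugate_le_of_subdiff hμ (hFc hf) hTm hT hsub)
  rw [EReal.coe_le_coe_iff] at h1
  have hW := W2sq_map_le (ρ := μ) measurable_id hTm
  rw [Measure.map_id, lintegral_half_normSq_sub hμ hT] at hW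
  refine hW.trans (ENNReal.ofReal_le_ofReal ?_)
  rw [integral_half_normSq_map hTm]
  simp only [id]
  linarith

/-- The cost of moving `μ` along a subgradient map of the cone is controlled by `W_{2,F}(μ, ν)` and
the distance from the push-forward to `ν`. -/
theorem lintegral_subgradient_map_le (hFc : F ⊆ cvx d) (hF : IsFunctionCone F)
    (hnorm : normSq d ∈ F) (hμ : MemLp id 2 μ) (hν : MemLp id 2 ν) {f : EFun d} (hf : f ∈ F)
    {T : Space d → Space d} (hTm : Measurable T) (hsub : ∀ᵐ x ∂μ, T x ∈ subdiff f x)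
    {π : Measure (Space d × Space d)} (hπ : π ∈ couplings (μ.map T) ν)
    (hfin : ∫⁻ p, ENNReal.ofReal (1 / 2 * ‖p.1 - p.2‖ ^ 2) ∂π ≠ ⊤) :
    ∫⁻ x, ENNReal.ofReal (1 / 2 * ‖x - T x‖ ^ 2) ∂μ ≤ 2 * (W2Fsq F μ ν).toENNReal +
      2 * ∫⁻ p, ENNReal.ofReal (1 / 2 * ‖p.1 - p.2‖ ^ 2) ∂π := by
  have : IsProbabilityMeasure (π.map Prod.snd) := by rw [hπ.2]; infer_instance
  have : IsProbabilityMeasure π := Measure.isProbabilityMeasure_of_map Prod.snd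
  have h2 : MemLp Prod.snd 2 π := by
    rw [← hπ.2] at hν; exact (memLp_id_map measurable_snd).1 hν
  have hd : MemLp (fun p : Space d × Space d => p.1 - p.2) 2 π :=
    memLp_two_of_lintegral_half_ne_top (by fun_prop) hfin
  -- The second moment of `T#μ` is not assumed; it comes from the finite cost of `π` and the second
  -- moment of `ν`.
  have h1 : MemLp Prod.fst 2 π := by
    refine (hd.add h2).ae_eq (Filter.Eventually.of_forall fun p => ?_)
    simp
  have hTμ : MemLp id 2 (μ.map T) := by rw [← hπ.1]; exact (memLp_id_map measurable_fst).2 h1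
  have hT := (memLp_id_map hTm).1 hTμ
  obtain ⟨V, hV, hVle⟩ := exists_isPrimalValue hFc hF hnorm hμ hν
  obtain ⟨S, hSm, hS, hlow, hVS⟩ := hV.exists_optimal_map hFc hF hnorm hμ hν
  obtain ⟨-, hmle⟩ := memLp_of_mem_lowerSet hnorm hμ hlow
  rw [integral_half_normSq_map hSm] at hmle
  have hSsm : Measurable fun p : Space d × Space d => S p.2 := hSm.comp measurable_snd
  have hmapS : π.map (fun p => S p.2) = ν.map S := by
    rw [← hπ.2, Measure.map_map hSm measurable_snd]; rfl
  have hSs : MemLp (fun p : Space d × Space d => S p.2) 2 π := by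
    rw [← memLp_id_map hSsm, hmapS]; exact (memLp_id_map hSm).2 hS
  -- Since `S#ν ⪯_F μ`, weak duality for the pair `(S p.2, p.1)` meets Fenchel's equality for the
  -- same `f`.
  have hA : ∫ p, (inner ℝ (S p.2) p.1 : ℝ) ∂π ≤ ∫ x, (inner ℝ x (T x) : ℝ) ∂μ := by
    rw [← EReal.coe_le_coe_iff]
    have := integral_inner_le_of_momentLE (μ := μ) hFc hSsm measurable_fst hSs h1
      (by rw [hmapS]; exact hlow.2) hf
    rw [hπ.1] at this
    exact this.trans (eintegral_add_conjugate_le_of_subdiff hμ (hFc hf) hTm hT hsub)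
  have hB := integral_half_normSq_sub hSs h1
  have hC := integral_half_normSq_sub hS hν
  have hD : ∫ p, 1 / 2 * ‖S p.2 - p.1‖ ^ 2 ∂π ≤
      2 * ∫ y, 1 / 2 * ‖S y - y‖ ^ 2 ∂ν + 2 * ∫ p, 1 / 2 * ‖p.1 - p.2‖ ^ 2 ∂π := by
    have hi1 : Integrable (fun p : Space d × Space d => 1 / 2 * ‖S p.2 - p.2‖ ^ 2) π :=
      integrable_half_normSq (hSs.sub h2)
    have e : ∫ y, 1 / 2 * ‖S y - y‖ ^ 2 ∂ν = ∫ p, 1 / 2 * ‖S p.2 - p.2‖ ^ 2 ∂π := by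
      rw [← hπ.2]
      exact integral_map measurable_snd.aemeasurable (by fun_prop)
    rw [e, ← integral_const_mul, ← integral_const_mul, ← integral_add (hi1.const_mul 2)
      ((integrable_half_normSq hd).const_mul 2)]
    refine integral_mono (integrable_half_normSq (hSs.sub h1))
      ((hi1.const_mul 2).add ((integrable_half_normSq hd).const_mul 2)) fun p => ?_
    have e1 : S p.2 - p.1 = (S p.2 - p.2) - (p.1 - p.2) := by abel
    have h3 := parallelogram_law_with_norm ℝ (S p.2 - p.2) (p.1 - p.2)
    beta_reduce
    rw [e1]
    nlinarith [mul_self_nonneg ‖S p.2 - p.2 + (p.1 - p.2)‖]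
  have e1 : ∫ p, 1 / 2 * ‖S p.2‖ ^ 2 ∂π = ∫ y, 1 / 2 * ‖S y‖ ^ 2 ∂ν := by
    rw [← integral_half_normSq_map hSsm, hmapS, integral_half_normSq_map hSm]
  have e2 : ∫ p, 1 / 2 * ‖p.1‖ ^ 2 ∂π = ∫ x, 1 / 2 * ‖T x‖ ^ 2 ∂μ := by
    rw [← integral_half_normSq_map measurable_fst, hπ.1, integral_half_normSq_map hTm]
  have hlin := lintegral_half_normSq_sub hμ hT
  simp only [id] at hlin hC
  rw [hlin, hV.toENNReal_W2Fsq hμ hν, lintegral_half_normSq hd]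
  have htwo : ∀ t, 2 * ENNReal.ofReal t = ENNReal.ofReal (2 * t) := fun t => by
    rw [ENNReal.ofReal_mul zero_le_two, ENNReal.ofReal_ofNat]
  have hdpos : 0 ≤ ∫ p, 1 / 2 * ‖p.1 - p.2‖ ^ 2 ∂π := integral_nonneg fun p => by positivity
  rw [htwo, htwo, ← ENNReal.ofReal_add (by linarith) (by linarith)]
  refine ENNReal.ofReal_le_ofReal ?_
  -- By `hA` the left side is at most `M(μ) - M(S#ν) + ∫ ½‖S p.2 - p.1‖² dπ`. By `hC` and `hVS`, `∫
  -- ½‖S y - y‖² dν` is at most `W²_{2,F} - (M(μ) - M(S#ν))`. Inserting this in `hD` leaves `-(M(μ)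
  -- - M(S#ν)) ≤ 0` to spare.
  linarith

omit [IsProbabilityMeasure μ] in
theorem mem_gradPush_self (hF : IsFunctionCone F) (hnorm : normSq d ∈ F) : μ ∈ gradPush F μ := by
  refine ⟨_, half_smul_normSq_mem hF hnorm, id, measurable_id, ?_, Measure.map_id.symm⟩
  refine Filter.Eventually.of_forall fun x z => ?_
  rw [← EReal.coe_add, EReal.coe_le_coe_iff, id, inner_sub_right, real_inner_self_eq_norm_sq]
  have := norm_sub_sq_real x z
  have := sq_nonneg ‖x - z‖
  linarith

theorem W2_le_of_mem_gradPush (hFc : F ⊆ cvx d) (hF : IsFunctionCone F) (hnorm : normSq d ∈ F)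
    (hμ : MemLp id 2 μ) (hν : MemLp id 2 ν) {κ : Measure (Space d)} (hκ : κ ∈ gradPush F μ) :
    W2 μ ν ≤ (2 * W2F F μ ν ^ 2 + 2 * W2 κ ν ^ 2) ^ (1 / 2 : ℝ) + W2 κ ν := by
  obtain ⟨f, hf, T, hTm, hsub, rfl⟩ := hκ
  refine (W2_le_add_W2_map hTm).trans (add_le_add_left ?_ _)
  refine ENNReal.rpow_le_rpow ?_ (by norm_num)
  rw [W2F_sq, W2_sq, W2sq, ENNReal.mul_iInf_of_ne two_ne_zero ENNReal.ofNat_ne_top,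
    ENNReal.add_iInf]
  refine le_iInf fun π => ?_
  by_cases hπ : π ∈ couplings (μ.map T) ν
  · simp only [hπ, iInf_pos]
    by_cases hfin : ∫⁻ p, ENNReal.ofReal (1 / 2 * ‖p.1 - p.2‖ ^ 2) ∂π = ⊤
    · rw [hfin]; simp
    · exact lintegral_subgradient_map_le hFc hF hnorm hμ hν hf hTm hsub hπ hfin
  · simp [hπ]

/-- The bound is continuous in the error, so it passes to the limit along a minimising sequence even
if `ε` is not attained. -/
theorem W2_le_approxError (hFc : F ⊆ cvx d) (hF : IsFunctionCone F) (hnorm : normSq d ∈ F)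
    (hμ : MemLp id 2 μ) (hν : MemLp id 2 ν) :
    W2 μ ν ≤ (2 * W2F F μ ν ^ 2 + 2 * approxError F μ ν ^ 2) ^ (1 / 2 : ℝ)
      + approxError F μ ν := by
  obtain ⟨t, -, ht, hmem⟩ := exists_seq_tendsto_sInf
    (S := (fun κ => W2 κ ν) '' gradPush F μ) ⟨_, μ, mem_gradPush_self hF hnorm, rfl⟩
    (OrderBot.bddBelow _)
  rw [sInf_image] at ht
  have hc : Continuous fun s : ℝ≥0∞ => (2 * W2F F μ ν ^ 2 + 2 * s ^ 2) ^ (1 / 2 : ℝ) + s := by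
    refine (ENNReal.continuous_rpow_const.comp (continuous_const.add ?_)).add continuous_id
    exact (ENNReal.continuous_const_mul ENNReal.ofNat_ne_top).comp (ENNReal.continuous_pow 2)
  refine ge_of_tendsto' ((hc.tendsto _).comp ht) fun n => ?_
  obtain ⟨κ, hκ, hκn⟩ := hmem n
  simp only [Function.comp_apply, ← hκn]
  exact W2_le_of_mem_gradPush hFc hF hnorm hμ hν hκ

theorem W2_ne_top (hμ : MemLp id 2 μ) (hν : MemLp id 2 ν) : W2 μ ν ≠ ⊤ :=
  ENNReal.rpow_ne_top_of_nonneg (by norm_num) (W2sq_ne_top hμ hν)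

theorem approxError_ne_top (hF : IsFunctionCone F) (hnorm : normSq d ∈ F) (hμ : MemLp id 2 μ)
    (hν : MemLp id 2 ν) : approxError F μ ν ≠ ⊤ :=
  ne_top_of_le_ne_top (W2_ne_top hμ hν) (iInf₂_le μ (mem_gradPush_self hF hnorm))

end duality

/-! ### Asymmetry from a one-sided cone -/

section asymmetry

/-- The cone generated by `‖·‖²` and a linear form. -/
def quadraticLinearCone {d : ℕ} (e : Space d) : Set (EFun d) :=
  {f | ∃ a b : ℝ, 0 ≤ a ∧ 0 ≤ b ∧ f = fun x => ((a * ‖x‖ ^ 2 + b * inner ℝ x e : ℝ) : EReal)}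

variable {d : ℕ} (e : Space d)

theorem quadraticLinearCone_subset_cvx : quadraticLinearCone e ⊆ cvx d := by
  rintro f ⟨a, b, ha, -, rfl⟩
  refine ⟨Continuous.lowerSemicontinuous (continuous_coe_real_ereal.comp (by fun_prop)), ?_,
    fun x => EReal.coe_ne_bot _, 0, EReal.coe_ne_top _⟩
  simp only [EReal.coe_le_coe_iff]
  have h : ConvexOn ℝ Set.univ fun x : Space d => a * ‖x‖ ^ 2 + b * inner ℝ x e := by
    refine ConvexOn.add ?_ ?_
    · exact ((convexOn_univ_norm (E := Space d)).pow (fun _ _ => norm_nonneg _) 2).smul ha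
    · refine ⟨convex_univ, fun x _ y _ s t _ _ _ => le_of_eq ?_⟩
      simp only [inner_add_left, inner_smul_left, conj_trivial, smul_eq_mul]
      ring
  simpa using h.convex_epigraph

theorem isFunctionCone_quadraticLinearCone : IsFunctionCone (quadraticLinearCone e) := by
  refine ⟨⟨_, 0, 0, le_rfl, le_rfl, rfl⟩, ?_⟩
  rintro f ⟨a, b, ha, hb, rfl⟩ g ⟨a', b', ha', hb', rfl⟩ α β hα hβ
  refine ⟨α * a + β * a', α * b + β * b', by positivity, by positivity, ?_⟩
  ext1 x
  rw [← EReal.coe_mul, ← EReal.coe_mul, ← EReal.coe_add]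
  congr 1
  ring

theorem normSq_mem_quadraticLinearCone : normSq d ∈ quadraticLinearCone e :=
  ⟨1, 0, zero_le_one, le_rfl, by ext x; simp [normSq]⟩

theorem memLp_id_dirac (x : Space d) : MemLp id 2 (Measure.dirac x) := by
  have h : id =ᵐ[Measure.dirac x] fun _ => x := by
    rw [Filter.EventuallyEq, ae_dirac_eq]; rfl
  exact (memLp_const x).ae_eq h.symm

theorem eintegral_dirac_coe (g : Space d → ℝ) (x : Space d) :
    eintegral (Measure.dirac x) (fun y => (g y : EReal)) = (g x : EReal) := by
  have hi : Integrable g (Measure.dirac x) := by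
    have h : g =ᵐ[Measure.dirac x] fun _ => g x := by
      rw [Filter.EventuallyEq, ae_dirac_eq]; rfl
    exact (integrable_const (g x)).congr h.symm
  rw [eintegral_eq_eint, eint_coe hi, integral_dirac]

/-- The Diracs at `±e` have equal second moments, while `⟨·, e⟩` belongs to the cone without its
negative and orders them strictly. Moment matching thus holds in one direction only. -/
theorem W2F_dirac_ne (he : e ≠ 0) :
    W2F (quadraticLinearCone e) (Measure.dirac e) (Measure.dirac (-e)) ≠
      W2F (quadraticLinearCone e) (Measure.dirac (-e)) (Measure.dirac e) := by
  have hpos : 0 < ‖e‖ ^ 2 := by positivity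
  have h1 : W2F (quadraticLinearCone e) (Measure.dirac e) (Measure.dirac (-e)) = 0 := by
    rw [W2F_eq_zero_iff (quadraticLinearCone_subset_cvx e) (isFunctionCone_quadraticLinearCone e)
      (normSq_mem_quadraticLinearCone e) (memLp_id_dirac _) (memLp_id_dirac _)]
    refine ⟨?_, by simp⟩
    rintro f ⟨a, b, ha, hb, rfl⟩
    rw [eintegral_dirac_coe, eintegral_dirac_coe,
      EReal.coe_le_coe_iff, inner_neg_left, norm_neg, real_inner_self_eq_norm_sq]
    nlinarith
  have h2 : W2F (quadraticLinearCone e) (Measure.dirac (-e)) (Measure.dirac e) ≠ 0 := by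
    rw [Ne, W2F_eq_zero_iff (quadraticLinearCone_subset_cvx e)
      (isFunctionCone_quadraticLinearCone e) (normSq_mem_quadraticLinearCone e)
      (memLp_id_dirac _) (memLp_id_dirac _)]
    rintro ⟨h, -⟩
    have := h _ ⟨0, 1, le_rfl, zero_le_one, rfl⟩
    rw [eintegral_dirac_coe, eintegral_dirac_coe,
      EReal.coe_le_coe_iff, inner_neg_left, norm_neg, real_inner_self_eq_norm_sq] at this
    linarith
  rw [h1]
  exact h2.symm

end asymmetry

end ConicOT

theorem theorem5 :
    (∀ (d : ℕ) (F : Set (ConicOT.EFun d)) (μ ν : Measure (ConicOT.Space d)),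
      IsProbabilityMeasure μ → IsProbabilityMeasure ν → MemLp id 2 μ → MemLp id 2 ν →
      F ⊆ ConicOT.cvx d → ConicOT.IsFunctionCone F → ConicOT.normSq d ∈ F →
      -- the squared quantity is a nonnegative real number, so that its root makes sense
      (0 ≤ ConicOT.W2Fsq F μ ν ∧ ConicOT.W2Fsq F μ ν ≠ ⊤) ∧
      -- duality
      (ConicOT.W2Fsq F μ ν =
          ⨅ κ ∈ ConicOT.lowerSet F μ,
            ((ConicOT.W2sq κ ν : EReal) + (ConicOT.halfMoment μ : EReal)
              - (ConicOT.halfMoment κ : EReal)) ∧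
        (⨅ κ ∈ ConicOT.lowerSet F μ, (ConicOT.W2sq κ ν : EReal)) ≤
          ⨅ κ ∈ ConicOT.lowerSet F μ,
            ((ConicOT.W2sq κ ν : EReal) + (ConicOT.halfMoment μ : EReal)
              - (ConicOT.halfMoment κ : EReal))) ∧
      -- moment matching
      (ConicOT.W2F F μ ν = 0 ↔
        ConicOT.MomentLE F ν μ ∧ ∫ x, ‖x‖ ^ 2 ∂μ = ∫ x, ‖x‖ ^ 2 ∂ν) ∧
      -- embedding
      (ν ∈ ConicOT.gradPush F μ → ConicOT.W2F F μ ν = ConicOT.W2 μ ν) ∧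
      (ν ∉ ConicOT.gradPush F μ →
        ConicOT.W2F F μ ν ≤ ConicOT.W2 μ ν ∧
        ConicOT.W2 μ ν ≤
          (2 * ConicOT.W2F F μ ν ^ 2 + 2 * ConicOT.approxError F μ ν ^ 2) ^ (1 / 2 : ℝ)
            + ConicOT.approxError F μ ν) ∧
      -- the error and the distance in the bounds are finite
      (ConicOT.approxError F μ ν ≠ ⊤ ∧ ConicOT.W2 μ ν ≠ ⊤)) ∧
    -- lack of symmetry
    (∃ (d : ℕ) (F : Set (ConicOT.EFun d)) (μ ν : Measure (ConicOT.Space d)),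
      IsProbabilityMeasure μ ∧ IsProbabilityMeasure ν ∧ MemLp id 2 μ ∧ MemLp id 2 ν ∧
      F ⊆ ConicOT.cvx d ∧ ConicOT.IsFunctionCone F ∧ ConicOT.normSq d ∈ F ∧
      ConicOT.W2F F μ ν ≠ ConicOT.W2F F ν μ) := by
  refine ⟨?_, ?_⟩
  · intro d F μ ν _ _ hμ hν hFc hF hnorm
    exact ⟨ConicOT.W2Fsq_nonneg hFc hF hnorm hμ hν,
      ⟨ConicOT.W2Fsq_duality hFc hF hnorm hμ hν, ConicOT.iInf_W2sq_le hnorm hμ⟩,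
      ConicOT.W2F_eq_zero_iff hFc hF hnorm hμ hν,
      ConicOT.W2F_eq_W2_of_mem_gradPush hFc hF hnorm hμ hν,
      fun _ => ⟨ConicOT.W2F_le_W2 hFc hF hnorm hμ hν,
        ConicOT.W2_le_approxError hFc hF hnorm hμ hν⟩,
      ConicOT.approxError_ne_top hF hnorm hμ hν, ConicOT.W2_ne_top hμ hν⟩
  · have he : (EuclideanSpace.single 0 1 : ConicOT.Space 1) ≠ 0 := by simp
    exact ⟨1, ConicOT.quadraticLinearCone (EuclideanSpace.single 0 1),
      Measure.dirac (EuclideanSpace.single 0 1), Measure.dirac (-EuclideanSpace.single 0 1),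
      inferInstance, inferInstance, ConicOT.memLp_id_dirac _, ConicOT.memLp_id_dirac _,
      ConicOT.quadraticLinearCone_subset_cvx _, ConicOT.isFunctionCone_quadraticLinearCone _,
      ConicOT.normSq_mem_quadraticLinearCone _, ConicOT.W2F_dirac_ne _ he⟩
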